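/- **Lemma (weighted Aubin–Lions).** All functions are real-valued. Let $X := H^1(\mathbb{R}^d)\cap L^2(\mathbb{R}^d,|v|^2\,dv)$, where $H^1(\mathbb{R}^d)$ is the usual Sobolev space and $L^2(\mathbb{R}^d,|v|^2\,dv)$ is the space of functions $f$ with $\int_{\mathbb{R}^d} |f(v)|^2|v|^2\,dv<\infty$; $X$ carries the norm $\max\{\|f\|_{H^1},\|f\|_{L^2(|v|^2dv)}\}$. Then the embedding $$X=H^1(\mathbb{R}^d)\cap L^2(\mathbb{R}^d,|v|^2\,dv)\hookrightarrow L^2(\mathbb{R}^d)$$ is compact. Moreover, let $0<T<\infty$, $k\ge 1$ real, and $p,q\in[1,\infty]$ with $(p,q)\neq(\infty,1)$. Let $H^{-k}(\mathbb{R}^d)$ be the dual of $H^k(\mathbb{R}^d)$, with $L^2(\mathbb{R}^d)$ regarded as a subspace of it through $f\mapsto\big(\varphi\mapsto\int f\varphi\big)$, and let $W^{1,q}(0,T;H^{-k}(\mathbb{R}^d))$ be the space of $w\in L^q(0,T;H^{-k}(\mathbb{R}^d))$ whose weak time derivative $\partial_t w$ lies in $L^q(0,T;H^{-k}(\mathbb{R}^d))$.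 Then the embedding $$L^p\big(0,T;\,H^1(\mathbb{R}^d)\cap L^2(\mathbb{R}^d,|v|^2\,dv)\big)\cap W^{1,q}\big(0,T;\,H^{-k}(\mathbb{R}^d)\big)\hookrightarrow L^p\big(0,T;\,L^2(\mathbb{R}^d)\big)$$ is compact, where the intersection carries the maximum of the two norms. -/

import Mathlib

open MeasureTheory Set
open scoped ENNReal ContDiff SchwartzMap

noncomputable section

namespace AubinLions

/-- `L²(ℝᵈ)`, real-valued functions. -/
abbrev L2 (d : ℕ) : Type :=
  Lp ℝ 2 (volume : Measure (EuclideanSpace ℝ (Fin d)))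

/-- `L²(ℝᵈ; ℝᵈ)`, square integrable vector fields. -/
abbrev L2Vec (d : ℕ) : Type :=
  Lp (EuclideanSpace ℝ (Fin d)) 2 (volume : Measure (EuclideanSpace ℝ (Fin d)))

/-- The measure `|v|² dv` on `ℝᵈ`. -/
def weightedMeasure (d : ℕ) : Measure (EuclideanSpace ℝ (Fin d)) :=
  volume.withDensity fun v => ENNReal.ofReal (‖v‖ ^ 2)

/-- The weighted space `L²(ℝᵈ, |v|² dv)`. -/
abbrev L2Weighted (d : ℕ) : Type := Lp ℝ 2 (weightedMeasure d)

/-- `g` is the weak gradient of `f`: `∫ f ∂ᵢφ = - ∫ gᵢ φ` for every test function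
`φ ∈ C_c^∞(ℝᵈ)` and every `i`. -/
def IsWeakGradient {d : ℕ} (f : EuclideanSpace ℝ (Fin d) → ℝ)
    (g : EuclideanSpace ℝ (Fin d) → EuclideanSpace ℝ (Fin d)) : Prop :=
  ∀ φ : EuclideanSpace ℝ (Fin d) → ℝ, ContDiff ℝ ∞ φ → HasCompactSupport φ → ∀ i : Fin d,
    ∫ x, f x * fderiv ℝ φ x (EuclideanSpace.single i 1) = - ∫ x, g x i * φ x

theorem integrable_mul_of_continuous {d : ℕ} {f ψ : EuclideanSpace ℝ (Fin d) → ℝ}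
    (hf : MemLp f 2 volume) (hψ : Continuous ψ) (hc : HasCompactSupport ψ) :
    Integrable (fun x => f x * ψ x) :=
  hf.integrable_mul (q := 2) (hψ.memLp_of_hasCompactSupport hc)

theorem continuous_partial {d : ℕ} {φ : EuclideanSpace ℝ (Fin d) → ℝ} (hφ : ContDiff ℝ ∞ φ)
    (v : EuclideanSpace ℝ (Fin d)) : Continuous fun x => fderiv ℝ φ x v :=
  (hφ.continuous_fderiv (by simp)).clm_apply continuous_const

theorem memLp_coord {d : ℕ} (g : L2Vec d) (i : Fin d) :
    MemLp (fun x => g x i) 2 volume :=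
  (EuclideanSpace.proj i : EuclideanSpace ℝ (Fin d) →L[ℝ] ℝ).comp_memLp' (Lp.memLp g)

/-- The Sobolev space `H¹(ℝᵈ)`: the functions `f ∈ L²(ℝᵈ)` that have a weak gradient in `L²`.
An element is recorded as the pair `(f, ∇f)`; the norm, inherited from the product, is
`max ‖f‖_{L²} ‖∇f‖_{L²}`, which is equivalent to the Hilbert norm of `H¹`. -/
def H1 (d : ℕ) : Submodule ℝ (L2 d × L2Vec d) where
  carrier := {u | IsWeakGradient u.1 u.2}
  zero_mem' := by
    intro φ _ _ i
    have h1 : ∫ x, (0 : L2 d) x * fderiv ℝ φ x (EuclideanSpace.single i 1) = 0 := by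
      refine integral_eq_zero_of_ae ?_
      filter_upwards [Lp.coeFn_zero ℝ 2 (volume : Measure (EuclideanSpace ℝ (Fin d)))] with x hx
      rw [hx, Pi.zero_apply, zero_mul]
    have h2 : ∫ x, (0 : L2Vec d) x i * φ x = 0 := by
      refine integral_eq_zero_of_ae ?_
      filter_upwards [Lp.coeFn_zero (EuclideanSpace ℝ (Fin d)) 2
        (volume : Measure (EuclideanSpace ℝ (Fin d)))] with x hx
      rw [hx, Pi.zero_apply, PiLp.zero_apply, zero_mul, Pi.zero_apply]
    simp only [Prod.fst_zero, Prod.snd_zero]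
    rw [h1, h2, neg_zero]
  add_mem' := by
    intro u w hu hw φ hφ hc i
    have hc' : HasCompactSupport fun x => fderiv ℝ φ x (EuclideanSpace.single i 1) :=
      hc.fderiv_apply ℝ _
    have h1 : ∫ x, (u + w).1 x * fderiv ℝ φ x (EuclideanSpace.single i 1)
        = ∫ x, (u.1 x * fderiv ℝ φ x (EuclideanSpace.single i 1)
          + w.1 x * fderiv ℝ φ x (EuclideanSpace.single i 1)) := by
      refine integral_congr_ae ?_
      filter_upwards [Lp.coeFn_add u.1 w.1] with x hx
      simp only [Prod.fst_add, hx, Pi.add_apply, add_mul]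
    have h2 : ∫ x, (u + w).2 x i * φ x = ∫ x, (u.2 x i * φ x + w.2 x i * φ x) := by
      refine integral_congr_ae ?_
      filter_upwards [Lp.coeFn_add u.2 w.2] with x hx
      simp only [Prod.snd_add, hx, Pi.add_apply, PiLp.add_apply, add_mul]
    rw [h1, h2, integral_add
        (integrable_mul_of_continuous (Lp.memLp u.1) (continuous_partial hφ _) hc')
        (integrable_mul_of_continuous (Lp.memLp w.1) (continuous_partial hφ _) hc'),
      integral_add
        (integrable_mul_of_continuous (memLp_coord u.2 i) hφ.continuous hc)
        (integrable_mul_of_continuous (memLp_coord w.2 i) hφ.continuous hc),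
      hu φ hφ hc i, hw φ hφ hc i, neg_add]
  smul_mem' := by
    intro c u hu φ hφ hc i
    have h1 : ∫ x, (c • u).1 x * fderiv ℝ φ x (EuclideanSpace.single i 1)
        = ∫ x, c * (u.1 x * fderiv ℝ φ x (EuclideanSpace.single i 1)) := by
      refine integral_congr_ae ?_
      filter_upwards [Lp.coeFn_smul c u.1] with x hx
      simp only [Prod.smul_fst, hx, Pi.smul_apply, smul_eq_mul, mul_assoc]
    have h2 : ∫ x, (c • u).2 x i * φ x = ∫ x, c * (u.2 x i * φ x) := by
      refine integral_congr_ae ?_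
      filter_upwards [Lp.coeFn_smul c u.2] with x hx
      simp only [Prod.smul_snd, hx, Pi.smul_apply, PiLp.smul_apply, smul_eq_mul, mul_assoc]
    rw [h1, h2, integral_const_mul, integral_const_mul, hu φ hφ hc i, mul_neg]

theorem weightedMeasure_absolutelyContinuous (d : ℕ) :
    weightedMeasure d ≪ (volume : Measure (EuclideanSpace ℝ (Fin d))) :=
  withDensity_absolutelyContinuous _ _

/-- The intersection `X = H¹(ℝᵈ) ∩ L²(ℝᵈ, |v|² dv)`, with the norm
`max ‖f‖_{H¹} ‖f‖_{L²(|v|² dv)}`. An element is a pair formed by an element of `H¹` and an element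
of the weighted space which are the same function. -/
def weightedH1Submodule (d : ℕ) : Submodule ℝ (H1 d × L2Weighted d) where
  carrier := {u | (u.2 : EuclideanSpace ℝ (Fin d) → ℝ) =ᵐ[weightedMeasure d] u.1.1.1}
  zero_mem' := by
    filter_upwards [Lp.coeFn_zero ℝ 2 (weightedMeasure d),
      (weightedMeasure_absolutelyContinuous d).ae_le
        (Lp.coeFn_zero ℝ 2 (volume : Measure (EuclideanSpace ℝ (Fin d))))] with x h1 h2
    exact h1.trans h2.symm
  add_mem' := by
    intro u w hu hw
    change ((u.2 + w.2 : L2Weighted d) : EuclideanSpace ℝ (Fin d) → ℝ)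
      =ᵐ[weightedMeasure d] (u.1.1.1 + w.1.1.1 : L2 d)
    filter_upwards [Lp.coeFn_add u.2 w.2,
      (weightedMeasure_absolutelyContinuous d).ae_le (Lp.coeFn_add u.1.1.1 w.1.1.1), hu, hw]
      with x h1 h2 h3 h4
    exact (h1.trans (congrArg₂ (· + ·) h3 h4)).trans h2.symm
  smul_mem' := by
    intro c u hu
    change ((c • u.2 : L2Weighted d) : EuclideanSpace ℝ (Fin d) → ℝ)
      =ᵐ[weightedMeasure d] (c • u.1.1.1 : L2 d)
    filter_upwards [Lp.coeFn_smul c u.2,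
      (weightedMeasure_absolutelyContinuous d).ae_le (Lp.coeFn_smul c u.1.1.1), hu]
      with x h1 h2 h3
    exact (h1.trans (congrArg (c • ·) h3)).trans h2.symm

/-- The normed space `X = H¹(ℝᵈ) ∩ L²(ℝᵈ, |v|² dv)`. -/
def WeightedH1 (d : ℕ) : Type := weightedH1Submodule d

instance (d : ℕ) : NormedAddCommGroup (WeightedH1 d) :=
  inferInstanceAs (NormedAddCommGroup (weightedH1Submodule d))

instance (d : ℕ) : NormedSpace ℝ (WeightedH1 d) :=
  inferInstanceAs (NormedSpace ℝ (weightedH1Submodule d))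

/-- The embedding `H¹(ℝᵈ) ∩ L²(ℝᵈ, |v|² dv) → L²(ℝᵈ)`, `f ↦ f`. -/
def weightedH1ToL2 (d : ℕ) : WeightedH1 d →L[ℝ] L2 d :=
  show weightedH1Submodule d →L[ℝ] L2 d from
    ContinuousLinearMap.fst ℝ (L2 d) (L2Vec d) ∘L (H1 d).subtypeL ∘L
      ContinuousLinearMap.fst ℝ (H1 d) (L2Weighted d) ∘L (weightedH1Submodule d).subtypeL

/-- A real function in `L²(ℝᵈ)` regarded as a complex-valued one. -/
def complexify (d : ℕ) :
    L2 d →L[ℝ] Lp ℂ 2 (volume : Measure (EuclideanSpace ℝ (Fin d))) :=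
  Complex.ofRealCLM.compLpL 2 volume

/-- The Sobolev space `Hˢ(ℝᵈ)` of real order `s ≥ 0`: the real functions `f ∈ L²(ℝᵈ)` such that
`𝓕⁻¹ ((1 + |ξ|²)^{s/2} 𝓕 f)` belongs to `L²`. An element is recorded as the pair of `f` and
this Bessel potential `w`; as `‖f‖ ≤ ‖w‖` for `s ≥ 0`, the norm inherited from the product is the
usual norm `‖w‖_{L²}` of `Hˢ`. -/
def Hs (d : ℕ) (s : ℝ) :
    Submodule ℝ (L2 d × Lp ℂ 2 (volume : Measure (EuclideanSpace ℝ (Fin d)))) where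
  carrier := {u | TemperedDistribution.besselPotential (EuclideanSpace ℝ (Fin d)) ℂ s
    (Lp.toTemperedDistribution (complexify d u.1)) = Lp.toTemperedDistribution u.2}
  zero_mem' := by
    simp only [Set.mem_ofPred_eq, ← Lp.toTemperedDistributionCLM_apply, Prod.fst_zero,
      Prod.snd_zero, map_zero]
  add_mem' := by
    intro u w hu hw
    simp only [Set.mem_ofPred_eq, ← Lp.toTemperedDistributionCLM_apply, Prod.fst_add,
      Prod.snd_add, map_add] at hu hw ⊢
    rw [hu, hw]
  smul_mem' := by
    intro c u hu
    have h1 : complexify d (c • u).1 = (c : ℂ) • complexify d u.1 := by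
      rw [Prod.smul_fst, map_smul]; rfl
    have h2 : (c • u).2 = (c : ℂ) • u.2 := rfl
    simp only [Set.mem_ofPred_eq, ← Lp.toTemperedDistributionCLM_apply] at hu ⊢
    rw [h1, h2, map_smul, map_smul, map_smul, hu]

/-- The Sobolev space `H^{-s}(ℝᵈ)` of negative order, the dual of `Hˢ(ℝᵈ)` with the dual norm. -/
def HNeg (d : ℕ) (s : ℝ) : Type := StrongDual ℝ (Hs d s)

instance (d : ℕ) (s : ℝ) : NormedAddCommGroup (HNeg d s) :=
  inferInstanceAs (NormedAddCommGroup (StrongDual ℝ (Hs d s)))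

instance (d : ℕ) (s : ℝ) : NormedSpace ℝ (HNeg d s) :=
  inferInstanceAs (NormedSpace ℝ (StrongDual ℝ (Hs d s)))

/-- The canonical map `L²(ℝᵈ) → H^{-s}(ℝᵈ)`, `f ↦ (φ ↦ ∫ f φ)`. -/
def l2ToHNeg (d : ℕ) (s : ℝ) : L2 d →L[ℝ] HNeg d s :=
  show L2 d →L[ℝ] StrongDual ℝ (Hs d s) from
    (ContinuousLinearMap.compL ℝ (Hs d s) (L2 d) ℝ).flip
      (ContinuousLinearMap.fst ℝ (L2 d) (Lp ℂ 2 (volume : Measure (EuclideanSpace ℝ (Fin d))))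
        ∘L (Hs d s).subtypeL) ∘L
      (ContinuousLinearMap.mul ℝ ℝ).lpPairing volume 2 2

/-- The canonical map is indeed `f ↦ (φ ↦ ∫ f φ)`. -/
theorem l2ToHNeg_apply (d : ℕ) (s : ℝ) (f : L2 d) (φ : Hs d s) :
    (show StrongDual ℝ (Hs d s) from l2ToHNeg d s f) φ = ∫ x, f x * φ.1.1 x :=
  ContinuousLinearMap.lpPairing_eq_integral (ContinuousLinearMap.mul ℝ ℝ) f φ.1.1

/-- Lebesgue measure on the time interval `(0, T)`. -/
abbrev timeMeasure (T : ℝ) : Measure ℝ := volume.restrict (Ioo 0 T)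

section Bochner

variable {X Y B : Type*} [NormedAddCommGroup X] [NormedSpace ℝ X]
  [NormedAddCommGroup Y] [NormedSpace ℝ Y] [NormedAddCommGroup B] [NormedSpace ℝ B]

/-- `g` is the weak time derivative of `w` on `(0, T)`: `∫ φ' w = - ∫ φ g` in `Y` for every
test function `φ ∈ C_c^∞(0, T)`. -/
def IsWeakTimeDeriv (T : ℝ) (w g : ℝ → Y) : Prop :=
  ∀ φ : ℝ → ℝ, ContDiff ℝ ∞ φ → HasCompactSupport φ → tsupport φ ⊆ Ioo 0 T →
    ∫ t in Ioo 0 T, deriv φ t • w t = - ∫ t in Ioo 0 T, φ t • g t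

theorem integrable_smul_time {T : ℝ} {q : ℝ≥0∞} [Fact (1 ≤ q)] (w : Lp Y q (timeMeasure T))
    {ψ : ℝ → ℝ} (hψ : Continuous ψ) (hc : HasCompactSupport ψ) :
    Integrable (fun t => ψ t • w t) (timeMeasure T) := by
  obtain ⟨C, hC⟩ := hψ.bounded_above_of_compact_support hc
  exact ((Lp.memLp w).integrable Fact.out).bdd_smul C hψ.aestronglyMeasurable
    (Filter.Eventually.of_forall hC)

/-- The Bochner–Sobolev space `W^{1,q}(0,T;Y)`: the functions `w ∈ L^q(0,T;Y)` that have a weak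
derivative in `L^q(0,T;Y)`. An element is recorded as the pair `(w, ∂ₜw)`, with the norm
`max ‖w‖ ‖∂ₜw‖`. -/
def SobolevTime (q : ℝ≥0∞) [Fact (1 ≤ q)] (T : ℝ) (Y : Type*) [NormedAddCommGroup Y]
    [NormedSpace ℝ Y] :
    Submodule ℝ (Lp Y q (timeMeasure T) × Lp Y q (timeMeasure T)) where
  carrier := {w | IsWeakTimeDeriv T w.1 w.2}
  zero_mem' := by
    intro φ _ _ _
    have h (ψ : ℝ → ℝ) :
        ∫ t in Ioo 0 T, ψ t • (0 : Lp Y q (timeMeasure T)) t = 0 := by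
      refine integral_eq_zero_of_ae ?_
      filter_upwards [Lp.coeFn_zero Y q (timeMeasure T)] with t ht
      rw [ht, Pi.zero_apply, smul_zero]
    simp only [Prod.fst_zero, Prod.snd_zero]
    rw [h, h, neg_zero]
  add_mem' := by
    intro u w hu hw φ hφ hc hs
    have h (a b : Lp Y q (timeMeasure T)) {ψ : ℝ → ℝ} (hψ : Continuous ψ)
        (hcψ : HasCompactSupport ψ) : ∫ t in Ioo 0 T, ψ t • (a + b) t
          = (∫ t in Ioo 0 T, ψ t • a t) + ∫ t in Ioo 0 T, ψ t • b t := by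
      rw [← integral_add (integrable_smul_time a hψ hcψ) (integrable_smul_time b hψ hcψ)]
      refine integral_congr_ae ?_
      filter_upwards [Lp.coeFn_add a b] with t ht
      simp only [ht, Pi.add_apply, smul_add]
    simp only [Prod.fst_add, Prod.snd_add]
    rw [h _ _ (hφ.continuous_deriv (by simp)) hc.deriv, h _ _ hφ.continuous hc,
      hu φ hφ hc hs, hw φ hφ hc hs, neg_add]
  smul_mem' := by
    intro c u hu φ hφ hc hs
    have h (a : Lp Y q (timeMeasure T)) (ψ : ℝ → ℝ) :
        ∫ t in Ioo 0 T, ψ t • (c • a) t = c • ∫ t in Ioo 0 T, ψ t • a t := by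
      rw [← integral_smul]
      refine integral_congr_ae ?_
      filter_upwards [Lp.coeFn_smul c a] with t ht
      simp only [ht, Pi.smul_apply, smul_comm c]
    simp only [Prod.smul_fst, Prod.smul_snd]
    rw [h, h, hu φ hφ hc hs, smul_neg]

/-- The intersection `L^p(0,T;X) ∩ W^{1,q}(0,T;Y)`, where values in `X` are regarded as values in
`Y` by means of `ι : X → Y`. The norm is the maximum of the two norms. -/
def EvolutionSpace (p q : ℝ≥0∞) [Fact (1 ≤ p)] [Fact (1 ≤ q)] (T : ℝ) (ι : X →L[ℝ] Y) :
    Submodule ℝ (Lp X p (timeMeasure T) × SobolevTime q T Y) where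
  carrier := {u | ∀ᵐ t ∂(timeMeasure T), u.2.1.1 t = ι (u.1 t)}
  zero_mem' := by
    change ∀ᵐ t ∂(timeMeasure T),
      (0 : Lp Y q (timeMeasure T)) t = ι ((0 : Lp X p (timeMeasure T)) t)
    filter_upwards [Lp.coeFn_zero Y q (timeMeasure T), Lp.coeFn_zero X p (timeMeasure T)]
      with t h1 h2
    rw [h1, h2, Pi.zero_apply, Pi.zero_apply, map_zero]
  add_mem' := by
    intro u w hu hw
    change ∀ᵐ t ∂(timeMeasure T), (u.2.1.1 + w.2.1.1) t = ι ((u.1 + w.1) t)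
    filter_upwards [Lp.coeFn_add u.2.1.1 w.2.1.1, Lp.coeFn_add u.1 w.1, hu, hw]
      with t h1 h2 h3 h4
    rw [h1, h2, Pi.add_apply, Pi.add_apply, h3, h4, map_add]
  smul_mem' := by
    intro c u hu
    change ∀ᵐ t ∂(timeMeasure T), (c • u.2.1.1) t = ι ((c • u.1) t)
    filter_upwards [Lp.coeFn_smul c u.2.1.1, Lp.coeFn_smul c u.1, hu] with t h1 h2 h3
    rw [h1, h2, Pi.smul_apply, Pi.smul_apply, h3, map_smul]

/-- For `j : X → B`, the map `L^p(0,T;X) ∩ W^{1,q}(0,T;Y) → L^p(0,T;B)`, `u ↦ j ∘ u`. -/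
def evolutionEmbedding (p q : ℝ≥0∞) [Fact (1 ≤ p)] [Fact (1 ≤ q)] (T : ℝ) (ι : X →L[ℝ] Y)
    (j : X →L[ℝ] B) : EvolutionSpace p q T ι →L[ℝ] Lp B p (timeMeasure T) :=
  j.compLpL p (timeMeasure T) ∘L
    ContinuousLinearMap.fst ℝ (Lp X p (timeMeasure T)) (SobolevTime q T Y) ∘L
      (EvolutionSpace p q T ι).subtypeL

/-- The map is indeed `u ↦ j ∘ u`. -/
theorem evolutionEmbedding_apply {p q : ℝ≥0∞} [Fact (1 ≤ p)] [Fact (1 ≤ q)] {T : ℝ}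
    {ι : X →L[ℝ] Y} {j : X →L[ℝ] B} (u : EvolutionSpace p q T ι) :
    ∀ᵐ t ∂(timeMeasure T), evolutionEmbedding p q T ι j u t = j (u.1.1 t) :=
  ContinuousLinearMap.coeFn_compLp j u.1.1

end Bochner

/-- The space
`L^p(0,T; H¹(ℝᵈ) ∩ L²(ℝᵈ, |v|² dv)) ∩ W^{1,q}(0,T; H^{-k}(ℝᵈ))`. -/
abbrev AubinLionsSpace (d : ℕ) (p q : ℝ≥0∞) [Fact (1 ≤ p)] [Fact (1 ≤ q)] (T k : ℝ) :
    Submodule ℝ (Lp (WeightedH1 d) p (timeMeasure T) × SobolevTime q T (HNeg d k)) :=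
  EvolutionSpace p q T (l2ToHNeg d k ∘L weightedH1ToL2 d)

/-- The embedding of `L^p(0,T; H¹(ℝᵈ) ∩ L²(ℝᵈ, |v|² dv)) ∩ W^{1,q}(0,T; H^{-k}(ℝᵈ))` into
`L^p(0,T; L²(ℝᵈ))`, `u ↦ u`. -/
def aubinLionsEmbedding (d : ℕ) (p q : ℝ≥0∞) [Fact (1 ≤ p)] [Fact (1 ≤ q)] (T k : ℝ) :
    AubinLionsSpace d p q T k →L[ℝ] Lp (L2 d) p (timeMeasure T) :=
  evolutionEmbedding p q T
    (l2ToHNeg d k ∘L weightedH1ToL2 d) (weightedH1ToL2 d)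

end AubinLions

end

noncomputable section

namespace AubinLions

/-! Both embeddings are limits, in operator norm, of compact operators built from finitely many
scalar quantities.

In space, $f$ is replaced by its averages over finitely many cubes of side $\delta$ that cover a
ball of radius $N\delta$. Inside the covered region the error is controlled by the gradient, through
$\|f(\cdot+h)-f\|_{L^2}\le|h|\,\|\nabla f\|_{L^2}$ integrated over the differences $h$ of points of
a common cube. Outside it the weight gives $|f|^2\le(N\delta)^{-2}|v|^2|f|^2$. With $\delta=1/n$ and
$N=n^2$ both errors vanish (`enorm_sub_gridAverage_sq_le`).

In time, Ehrling's inequality is replaced by the Hilbert structure of $L^2$. The compact embedding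
$j:X\to L^2$ is a norm limit of operators $x\mapsto\sum_i\langle\varphi_i,jx\rangle e_i$, and since
$H^k$ is dense in $L^2$ the $\varphi_i$ may be taken in $H^k$ (`exists_finite_rank_approx`,
`dense_range_Hs_fst`). Each $\varphi_i$ is then a functional on $H^{-k}$, so
$a_i(t)=\langle\varphi_i,u(t)\rangle$ is a scalar function with weak derivative in $L^q(0,T)$. It
remains to treat scalar functions.

For these, averaging over $N$ intervals of length $\delta=T/N$ has finite rank, and on each interval
the error is at most $\int|a'|$ over that interval. Its $L^p$ norm is at most
$\delta^{1/p}\|a'\|_{L^1}$ if $p<\infty$, and $\delta^{1-1/q}\|a'\|_{L^q}$ if $p=\infty$. The power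
of $\delta$ is positive except for $(p,q)=(\infty,1)$ (`norm_sub_timeAverage_le`).

Injectivity amounts to uniqueness of weak derivatives, because elements of the spaces are recorded
together with their derivatives. -/

/-! ### Compact operators and finite rank approximation -/

theorem isCompactOperator_of_forall_norm_sub_le {E F : Type*} [NormedAddCommGroup E]
    [NormedSpace ℝ E] [NormedAddCommGroup F] [NormedSpace ℝ F] [CompleteSpace F] (T : E →L[ℝ] F)
    (h : ∀ ε : ℝ, 0 < ε → ∃ S : E →L[ℝ] F, IsCompactOperator S ∧ ∀ x, ‖T x - S x‖ ≤ ε * ‖x‖) :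
    IsCompactOperator T := by
  have hc := isClosed_setOfPred_isCompactOperator (σ₁₂ := RingHom.id ℝ) (M₁ := E) (M₂ := F)
  refine hc.closure_subset (Metric.mem_closure_iff.2 fun ε hε => ?_)
  obtain ⟨S, hS, hST⟩ := h (ε / 2) (half_pos hε)
  refine ⟨S, hS, ?_⟩
  rw [dist_eq_norm]
  exact (ContinuousLinearMap.opNorm_le_bound _ (half_pos hε).le hST).trans_lt (half_lt_self hε)

theorem isCompactOperator_sum {E F ι : Type*} [NormedAddCommGroup E] [NormedSpace ℝ E]
    [NormedAddCommGroup F] [NormedSpace ℝ F] (s : Finset ι) (f : ι → E →L[ℝ] F)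
    (hf : ∀ i ∈ s, IsCompactOperator (f i)) : IsCompactOperator (∑ i ∈ s, f i : E →L[ℝ] F) :=
  Submodule.sum_mem (compactOperator (RingHom.id ℝ) E F) hf

theorem isCompactOperator_smulRight {E F : Type*} [NormedAddCommGroup E] [NormedSpace ℝ E]
    [NormedAddCommGroup F] [NormedSpace ℝ F] (l : E →L[ℝ] ℝ) (y : F) :
    IsCompactOperator (l.smulRight y) := by
  have h : IsCompactOperator (ContinuousLinearMap.toSpanSingleton ℝ y) :=
    isCompactOperator_of_locallyCompactSpace_rng _
  exact h.comp_clm l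

/-- A compact operator into a Hilbert space is a norm limit of finite rank operators, and the
functionals in them may be taken from a dense set. -/
theorem exists_finite_rank_approx {X B : Type*} [NormedAddCommGroup X] [NormedSpace ℝ X]
    [NormedAddCommGroup B] [InnerProductSpace ℝ B] (j : X →L[ℝ] B) (hj : IsCompactOperator j)
    {D : Set B} (hD : Dense D) {ε : ℝ} (hε : 0 < ε) :
    ∃ (n : ℕ) (φ e : Fin n → B), (∀ i, φ i ∈ D) ∧
      ∀ x, ‖j x - ∑ i, inner ℝ (φ i) (j x) • e i‖ ≤ ε * ‖x‖ := by
  have hK : TotallyBounded (j '' Metric.closedBall 0 1) :=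
    (IsCompactOperator.isCompact_closure_image_closedBall (f := j.toLinearMap) hj
      1).totallyBounded.subset subset_closure
  obtain ⟨t, ht, hcov⟩ := Metric.totallyBounded_iff.1 hK (ε / 2) (half_pos hε)
  -- `V` is spanned by a finite `ε / 2`-net of the image of the unit ball, so projecting onto `V`
  -- costs at most `ε / 2 * ‖x‖`.
  let V : Submodule ℝ B := Submodule.span ℝ t
  have : FiniteDimensional ℝ V := FiniteDimensional.span_of_finite ℝ ht
  let b := stdOrthonormalBasis ℝ V
  let n := Module.finrank ℝ V
  -- Moving the `n` basis vectors into `D` costs at most `n * δ * ‖j‖ * ‖x‖`, which this `δ` keeps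
  -- below `ε / 2 * ‖x‖`. The added ones keep the denominator positive.
  let δ : ℝ := ε / (2 * ((n : ℝ) + 1) * (‖j‖ + 1))
  have hδ : 0 < δ := by positivity
  have hφ (i : Fin n) : ∃ φ ∈ D, ‖(b i : B) - φ‖ < δ := by
    obtain ⟨φ, hφD, hφ⟩ := Metric.mem_closure_iff.1 (hD (b i : B)) δ hδ
    exact ⟨φ, hφD, by rwa [← dist_eq_norm]⟩
  choose φ hφD hφ using hφ
  refine ⟨n, φ, fun i => (b i : B), hφD, fun x => ?_⟩
  have hbn (i : Fin n) : ‖(b i : B)‖ = 1 := b.orthonormal.1 i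
  have hproj (y : B) : V.starProjection y = ∑ i, inner ℝ (b i : B) y • (b i : B) := by
    rw [Submodule.starProjection_apply, ← b.sum_repr (V.orthogonalProjectionOnto y)]
    simp [b.repr_apply_apply]
  have h1 : ‖j x - V.starProjection (j x)‖ ≤ ε / 2 * ‖x‖ := by
    rcases eq_or_ne x 0 with rfl | hx
    · simp
    have hxn : 0 < ‖x‖ := norm_pos_iff.2 hx
    have hmem : j (‖x‖⁻¹ • x) ∈ j '' Metric.closedBall 0 1 := by
      refine ⟨_, ?_, rfl⟩
      simp [norm_smul, hxn.ne']
    obtain ⟨y, hy, hxy⟩ := mem_iUnion₂.1 (hcov hmem)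
    have hyV : ‖x‖ • y ∈ V := V.smul_mem _ (Submodule.subset_span hy)
    have h2 : ‖j x - V.starProjection (j x)‖ ≤ ‖j x - ‖x‖ • y‖ := by
      rw [Submodule.starProjection_minimal]
      exact ciInf_le ⟨0, by rintro _ ⟨z, rfl⟩; exact norm_nonneg _⟩ (⟨_, hyV⟩ : V)
    refine h2.trans ?_
    rw [Metric.mem_ball, dist_eq_norm] at hxy
    have h3 : j x - ‖x‖ • y = ‖x‖ • (j (‖x‖⁻¹ • x) - y) := by
      rw [map_smul, smul_sub, smul_smul, mul_inv_cancel₀ hxn.ne', one_smul]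
    rw [h3, norm_smul, norm_norm, mul_comm]
    gcongr
  have h2 : ‖V.starProjection (j x) - ∑ i, inner ℝ (φ i) (j x) • (b i : B)‖
      ≤ ε / 2 * ‖x‖ := by
    rw [hproj, ← Finset.sum_sub_distrib]
    calc _ ≤ ∑ i : Fin n, δ * (‖j‖ * ‖x‖) := by
          refine norm_sum_le_of_le _ fun i _ => ?_
          rw [← sub_smul, ← inner_sub_left, norm_smul, hbn, mul_one]
          refine (norm_inner_le_norm _ _).trans ?_
          gcongr
          · exact (hφ i).le
          · exact j.le_opNorm x
      _ ≤ ε / 2 * ‖x‖ := by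
          rw [Finset.sum_const, Finset.card_univ, Fintype.card_fin, nsmul_eq_mul]
          have h4 : (n : ℝ) * (δ * ‖j‖) ≤ ((n : ℝ) + 1) * (δ * (‖j‖ + 1)) := by
            gcongr <;> linarith
          have h5 : ((n : ℝ) + 1) * (δ * (‖j‖ + 1)) = ε / 2 := by
            simp only [δ]; field_simp
          calc (n : ℝ) * (δ * (‖j‖ * ‖x‖)) = (n : ℝ) * (δ * ‖j‖) * ‖x‖ := by ring
            _ ≤ _ := by rw [← h5]; gcongr
  calc _ ≤ ‖j x - V.starProjection (j x)‖ +
        ‖V.starProjection (j x) - ∑ i, inner ℝ (φ i) (j x) • (b i : B)‖ :=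
        norm_sub_le_norm_sub_add_norm_sub _ _ _
    _ ≤ ε * ‖x‖ := by linarith

/-! ### Averages over the fibers of a measurable map -/

section StepAverage

variable {α β : Type*} [MeasurableSpace α] {μ : Measure α} {p : ℝ≥0∞}

theorem coeFn_finset_sum {ι : Type*} (s : Finset ι) (f : ι → Lp ℝ p μ) :
    (∑ i ∈ s, f i : Lp ℝ p μ) =ᵐ[μ] fun x => ∑ i ∈ s, f i x := by
  classical
  induction s using Finset.induction_on with
  | empty =>
    simp only [Finset.sum_empty]
    exact Lp.coeFn_zero ℝ p μ
  | insert a s ha ih =>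
    rw [Finset.sum_insert ha]
    filter_upwards [Lp.coeFn_add (f a) (∑ i ∈ s, f i), ih] with x h1 h2
    rw [h1, Pi.add_apply, h2, Finset.sum_insert ha]

variable [Fact (1 ≤ p)]

/-- Hölder's inequality against the constant 1 on `A`. For `p = ⊤` the conventions `⊤.toReal = 0`
and `1 / 0 = 0` give the exponent 1, which is the correct one. -/
theorem setLIntegral_enorm_le_of_memLp {f : α → ℝ} (hf : MemLp f p μ) (A : Set α) :
    ∫⁻ x in A, ‖f x‖ₑ ∂μ ≤ eLpNorm f p μ * μ A ^ (1 - 1 / p.toReal) := by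
  rw [← eLpNorm_one_eq_lintegral_enorm]
  have := eLpNorm_le_eLpNorm_mul_rpow_measure_univ (Fact.out : 1 ≤ p)
    (hf.restrict A).aestronglyMeasurable
  rw [Measure.restrict_apply_univ] at this
  refine this.trans ?_
  simp only [ENNReal.toReal_one, div_one]
  gcongr
  exact Measure.restrict_le_self

theorem one_sub_one_div_toReal_nonneg (p : ℝ≥0∞) [Fact (1 ≤ p)] :
    (0 : ℝ) ≤ 1 - 1 / p.toReal := by
  rcases eq_or_ne p ⊤ with rfl | hp
  · simp
  · have : (1 : ℝ) ≤ p.toReal := by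
      simpa using ENNReal.toReal_mono hp (Fact.out : 1 ≤ p)
    rw [sub_nonneg]
    exact (div_le_one (by positivity)).2 this

theorem integrableOn_of_Lp (f : Lp ℝ p μ) {A : Set α} (hA : μ A ≠ ⊤) :
    IntegrableOn f A μ := by
  have : IsFiniteMeasure (μ.restrict A) := ⟨by simpa using hA.lt_top⟩
  exact ((Lp.memLp f).restrict A).integrable Fact.out

/-- Integration over a set of finite measure, as a continuous functional on `L^p`. -/
def setIntegralCLM (p : ℝ≥0∞) [Fact (1 ≤ p)] (A : Set α) (hA : μ A ≠ ⊤) : Lp ℝ p μ →L[ℝ] ℝ :=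
  LinearMap.mkContinuous
    { toFun := fun f => ∫ x in A, f x ∂μ
      map_add' := fun f g => by
        rw [← integral_add (integrableOn_of_Lp f hA) (integrableOn_of_Lp g hA)]
        exact integral_congr_ae (ae_restrict_of_ae (Lp.coeFn_add f g))
      map_smul' := fun c f => by
        rw [RingHom.id_apply, ← integral_smul]
        exact integral_congr_ae (ae_restrict_of_ae (Lp.coeFn_smul c f)) }
    (μ A ^ (1 - 1 / p.toReal)).toReal fun f => by
      have h := (enorm_integral_le_lintegral_enorm (μ := μ.restrict A) f).trans
        (setLIntegral_enorm_le_of_memLp (Lp.memLp f) A)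
      have hr := one_sub_one_div_toReal_nonneg p
      have := ENNReal.toReal_mono (ENNReal.mul_ne_top (Lp.eLpNorm_ne_top f)
        (ENNReal.rpow_ne_top_of_nonneg hr hA)) h
      rw [toReal_enorm, ENNReal.toReal_mul, mul_comm] at this
      exact this

/-- The operator that replaces a function by its averages over those fibers `k ⁻¹' {i}` for which
`i ∈ s`, and by zero elsewhere. -/
def stepAverage [MeasurableSpace β] [MeasurableSingletonClass β] (p : ℝ≥0∞) [Fact (1 ≤ p)]
    {k : α → β} (hk : Measurable k) (hfin : ∀ i, μ (k ⁻¹' {i}) ≠ ⊤) (s : Finset β) :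
    Lp ℝ p μ →L[ℝ] Lp ℝ p μ :=
  ∑ i ∈ s, (setIntegralCLM p (k ⁻¹' {i}) (hfin i)).smulRight
    (indicatorConstLp p (hk (measurableSet_singleton i)) (hfin i) ((μ.real (k ⁻¹' {i}))⁻¹))

variable [MeasurableSpace β] [MeasurableSingletonClass β] {k : α → β} (hk : Measurable k)
  (hfin : ∀ i, μ (k ⁻¹' {i}) ≠ ⊤) (s : Finset β)

theorem isCompactOperator_stepAverage : IsCompactOperator (stepAverage p hk hfin s) :=
  isCompactOperator_sum _ _ fun _ _ => isCompactOperator_smulRight _ _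

theorem stepAverage_ae_eq [DecidableEq β] (f : Lp ℝ p μ) :
    stepAverage p hk hfin s f =ᵐ[μ]
      fun x => if k x ∈ s then ⨍ y in k ⁻¹' {k x}, f y ∂μ else 0 := by
  have h1 : stepAverage p hk hfin s f = ∑ i ∈ s, (∫ y in k ⁻¹' {i}, f y ∂μ) •
      indicatorConstLp p (hk (measurableSet_singleton i)) (hfin i)
        ((μ.real (k ⁻¹' {i}))⁻¹) := by
    simp only [stepAverage, sum_apply]
    rfl
  rw [h1]
  have h2 : ∀ᵐ x ∂μ, ∀ i ∈ s, ((∫ y in k ⁻¹' {i}, f y ∂μ) •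
      indicatorConstLp p (hk (measurableSet_singleton i)) (hfin i)
        ((μ.real (k ⁻¹' {i}))⁻¹) : Lp ℝ p μ) x
      = if k x = i then ⨍ y in k ⁻¹' {i}, f y ∂μ else 0 := by
    refine (Finset.eventually_all s).2 fun i _ => ?_
    filter_upwards [Lp.coeFn_smul (∫ y in k ⁻¹' {i}, f y ∂μ)
      (indicatorConstLp p (hk (measurableSet_singleton i)) (hfin i) ((μ.real (k ⁻¹' {i}))⁻¹)),
      indicatorConstLp_coeFn (p := p) (hs := hk (measurableSet_singleton i)) (hμs := hfin i)
        (c := (μ.real (k ⁻¹' {i}))⁻¹)] with x hx1 hx2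
    classical
    -- Null fibers need no separate treatment: on both sides the normalizing factor is `0⁻¹ = 0`.
    rw [hx1, Pi.smul_apply, hx2, indicator_apply, mem_preimage, mem_singleton_iff,
      setAverage_eq]
    split_ifs <;> simp [mul_comm]
  filter_upwards [coeFn_finset_sum s (fun i => (∫ y in k ⁻¹' {i}, f y ∂μ) •
      indicatorConstLp p (hk (measurableSet_singleton i)) (hfin i)
        ((μ.real (k ⁻¹' {i}))⁻¹)), h2] with x hx1 hx2
  rw [hx1, Finset.sum_congr rfl hx2, Finset.sum_ite_eq]

/-- There are only countably many null fibers, so their union is null. Hence the average over the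
fiber of `x` is a genuine average for almost every `x`. -/
theorem ae_measure_fiber_ne_zero {β : Type*} [Countable β] (μ : Measure α) (k : α → β) :
    ∀ᵐ x ∂μ, μ (k ⁻¹' {k x}) ≠ 0 := by
  have h : ∀ i, ∀ᵐ x ∂μ, μ (k ⁻¹' {i}) = 0 → k x ≠ i := fun i => by
    by_cases hi : μ (k ⁻¹' {i}) = 0
    · filter_upwards [compl_mem_ae_iff.2 hi] with x hx _ using hx
    · exact Filter.Eventually.of_forall fun x h => absurd h hi
  filter_upwards [ae_all_iff.2 h] with x hx h0 using hx _ h0 rfl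

end StepAverage

/-! ### Weak derivatives on an interval -/

/-- A smooth function with zero mean and compact support in `(0, T)` is the derivative of
such a function. -/
theorem exists_antideriv_of_integral_eq_zero {T : ℝ} {θ : ℝ → ℝ} (hθ : ContDiff ℝ ∞ θ)
    (hc : HasCompactSupport θ) (hs : tsupport θ ⊆ Ioo 0 T) (h0 : ∫ t, θ t = 0) :
    ∃ φ : ℝ → ℝ, ContDiff ℝ ∞ φ ∧ HasCompactSupport φ ∧ tsupport φ ⊆ Ioo 0 T ∧
      deriv φ = θ := by
  rcases (tsupport θ).eq_empty_or_nonempty with he | hne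
  · rw [tsupport_eq_empty_iff] at he
    subst he
    exact ⟨0, contDiff_const, HasCompactSupport.zero, by simp [tsupport], by ext t; simp⟩
  set α := sInf (tsupport θ)
  set β := sSup (tsupport θ)
  have hcK : IsCompact (tsupport θ) := hc
  have hα : α ∈ Ioo 0 T := hs (hcK.sInf_mem hne)
  have hβ : β ∈ Ioo 0 T := hs (hcK.sSup_mem hne)
  have hsub : tsupport θ ⊆ Icc α β := fun t ht =>
    ⟨csInf_le hcK.bddBelow ht, le_csSup hcK.bddAbove ht⟩
  have hzero : ∀ t, t ∉ Icc α β → θ t = 0 := fun t ht =>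
    image_eq_zero_of_notMem_tsupport fun h => ht (hsub h)
  have hder : ∀ t, HasDerivAt (fun t => ∫ s in (0 : ℝ)..t, θ s) (θ t) t := fun t =>
    intervalIntegral.integral_hasDerivAt_right (hθ.continuous.intervalIntegrable _ _)
      (hθ.continuous.stronglyMeasurableAtFilter _ _) hθ.continuous.continuousAt
  have hderiv : deriv (fun t => ∫ s in (0 : ℝ)..t, θ s) = θ := funext fun t => (hder t).deriv
  -- The primitive vanishes to the left of the support because `θ` does, and to the right because
  -- the total integral is zero.
  have hsupp : tsupport (fun t => ∫ s in (0 : ℝ)..t, θ s) ⊆ Icc α β := by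
    refine closure_minimal (fun t ht => ?_) isClosed_Icc
    by_contra hmem
    apply ht
    rw [mem_Icc, not_and_or, not_le, not_le] at hmem
    rcases hmem with h | h
    · refine intervalIntegral.integral_zero_ae (Filter.Eventually.of_forall fun s hs => ?_)
      refine hzero s fun hs' => ?_
      have : s ≤ max 0 t := hs.2
      have h3 : max 0 t < α := max_lt hα.1 h
      linarith [hs'.1]
    · show ∫ s in (0 : ℝ)..t, θ s = 0
      rw [intervalIntegral.integral_eq_integral_of_support_subset, h0]
      intro s hs
      have := hsub (subset_tsupport θ hs)
      exact ⟨hα.1.trans_le this.1, this.2.trans h.le⟩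
  refine ⟨fun t => ∫ s in (0 : ℝ)..t, θ s, ?_, ?_, ?_, hderiv⟩
  · exact contDiff_infty_iff_deriv.2 ⟨fun t => (hder t).differentiableAt, by rwa [hderiv]⟩
  · exact isCompact_Icc.of_isClosed_subset (isClosed_tsupport _) hsupp
  · exact hsupp.trans fun t ht => ⟨hα.1.trans_le ht.1, ht.2.trans_lt hβ.2⟩

/-- The lemma of du Bois-Reymond. -/
theorem exists_ae_eq_const_of_integral_deriv_mul_eq_zero {T : ℝ} (hT : 0 < T) {h : ℝ → ℝ}
    (hh : IntegrableOn h (Ioo 0 T))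
    (h0 : ∀ φ : ℝ → ℝ, ContDiff ℝ ∞ φ → HasCompactSupport φ → tsupport φ ⊆ Ioo 0 T →
      ∫ t in Ioo 0 T, deriv φ t * h t = 0) :
    ∃ c, ∀ᵐ t ∂(timeMeasure T), h t = c := by
  -- A fixed bump of integral 1, supported well inside `(0, T)`; subtracting a multiple of it gives
  -- any test function zero mean.
  let f : ContDiffBump (T / 2) := ⟨T / 8, T / 4, by positivity, by linarith⟩
  let ψ₀ : ℝ → ℝ := f.normed volume
  have hψ₀ : ContDiff ℝ ∞ ψ₀ := f.contDiff_normed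
  have hψ₀c : HasCompactSupport ψ₀ := f.hasCompactSupport_normed
  have hψ₀s : tsupport ψ₀ ⊆ Ioo 0 T := by
    rw [f.tsupport_normed_eq, Real.closedBall_eq_Icc]
    intro t ht
    have h1 : T / 2 - T / 4 ≤ t := ht.1
    have h2 : t ≤ T / 2 + T / 4 := ht.2
    constructor <;> linarith
  have hψ₀i : ∫ t, ψ₀ t = 1 := f.integral_normed
  set c := ∫ t in Ioo 0 T, ψ₀ t * h t
  have hprod {ψ : ℝ → ℝ} (hψ : ContDiff ℝ ∞ ψ) (hc : HasCompactSupport ψ) :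
      IntegrableOn (fun t => ψ t * h t) (Ioo 0 T) := by
    obtain ⟨C, hC⟩ := hψ.continuous.bounded_above_of_compact_support hc
    exact hh.bdd_mul (c := C) hψ.continuous.aestronglyMeasurable (Filter.Eventually.of_forall hC)
  refine ⟨c, ?_⟩
  have key : ∀ ψ : ℝ → ℝ, ContDiff ℝ ∞ ψ → HasCompactSupport ψ → tsupport ψ ⊆ Ioo 0 T →
      ∫ t, ψ t • (h t - c) = 0 := by
    intro ψ hψ hc hs
    -- `θ` has zero mean, so it is the derivative of an admissible test function. The hypothesis
    -- then says that `h` and the constant `c` have the same integral against `ψ`.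
    let θ : ℝ → ℝ := fun t => ψ t - (∫ t, ψ t) * ψ₀ t
    have hsub : tsupport θ ⊆ tsupport ψ ∪ tsupport ψ₀ := by
      refine closure_minimal (fun t ht => ?_) ((isClosed_tsupport _).union (isClosed_tsupport _))
      by_contra hmem
      rw [mem_union, not_or] at hmem
      apply ht
      simp only [θ, image_eq_zero_of_notMem_tsupport hmem.1,
        image_eq_zero_of_notMem_tsupport hmem.2, mul_zero, sub_zero]
    obtain ⟨φ, h1, h2, h3, h4⟩ := exists_antideriv_of_integral_eq_zero
      (T := T) (θ := θ) (hψ.sub (contDiff_const.mul hψ₀))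
      ((hc.isCompact.union hψ₀c.isCompact).of_isClosed_subset (isClosed_tsupport _) hsub)
      (hsub.trans (union_subset hs hψ₀s)) (by
        simp only [θ]
        rw [integral_sub (hψ.continuous.integrable_of_hasCompactSupport hc)
          ((hψ₀.continuous.integrable_of_hasCompactSupport hψ₀c).const_mul _),
          integral_const_mul, hψ₀i, mul_one, sub_self])
    have h5 := h0 φ h1 h2 h3
    rw [h4] at h5
    have h6 : ∫ t in Ioo 0 T, θ t * h t
        = (∫ t in Ioo 0 T, ψ t * h t) - (∫ t, ψ t) * c := by
      rw [← integral_const_mul, ← integral_sub (hprod hψ hc) ((hprod hψ₀ hψ₀c).const_mul _)]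
      refine integral_congr_ae (Filter.Eventually.of_forall fun t => ?_)
      simp only [θ]; ring
    have hout : ∀ t ∉ Ioo 0 T, ψ t = 0 := fun t ht =>
      image_eq_zero_of_notMem_tsupport fun h => ht (hs h)
    have h7 : ∫ t in Ioo 0 T, ψ t = ∫ t, ψ t :=
      setIntegral_eq_integral_of_forall_compl_eq_zero hout
    have h8 : ∫ t, ψ t • (h t - c) = ∫ t in Ioo 0 T, ψ t • (h t - c) :=
      (setIntegral_eq_integral_of_forall_compl_eq_zero fun t ht => by
        rw [hout t ht, zero_smul]).symm
    rw [h8]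
    simp only [smul_eq_mul, mul_sub]
    rw [integral_sub (hprod hψ hc)
      ((hψ.continuous.integrable_of_hasCompactSupport hc).integrableOn.mul_const c),
      integral_mul_const, h7, ← h6, h5]
  have := isOpen_Ioo.ae_eq_zero_of_integral_contDiff_smul_eq_zero
    (hh.sub (integrableOn_const (by simp))).locallyIntegrableOn key
  rw [ae_restrict_iff' measurableSet_Ioo]
  filter_upwards [this] with t ht hmem
  exact sub_eq_zero.1 (ht hmem)

/-- A function with an integrable weak derivative is, up to a constant, the primitive of the
latter. -/
theorem exists_ae_eq_const_add_integral {T : ℝ} (hT : 0 < T) {a g : ℝ → ℝ}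
    (ha : IntegrableOn a (Ioo 0 T)) (hg : IntegrableOn g (Ioo 0 T))
    (h : IsWeakTimeDeriv T a g) :
    ∃ c, ∀ᵐ t ∂(timeMeasure T), a t = c + ∫ s in (0 : ℝ)..t, g s := by
  have hgi : IntervalIntegrable g volume 0 T := by
    rwa [intervalIntegrable_iff_integrableOn_Ioo_of_le hT.le]
  have hac := hgi.absolutelyContinuousOnInterval_intervalIntegral (c := 0) left_mem_uIcc
  have hVi : IntegrableOn (fun t => ∫ s in (0 : ℝ)..t, g s) (Ioo 0 T) :=
    (hac.continuousOn.integrableOn_compact isCompact_uIcc).mono_set (by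
      rw [uIcc_of_le hT.le]; exact Ioo_subset_Icc_self)
  -- The primitive of `g` is absolutely continuous, so integration by parts shows that `g` is its
  -- weak derivative. Its difference from `a` therefore has weak derivative zero.
  obtain ⟨c, hc⟩ := exists_ae_eq_const_of_integral_deriv_mul_eq_zero hT (ha.sub hVi) (by
    intro φ hφ hφc hφs
    have hφ0 : φ 0 = 0 := image_eq_zero_of_notMem_tsupport fun h => by simpa using hφs h
    have hφT : φ T = 0 := image_eq_zero_of_notMem_tsupport fun h => by simpa using hφs h
    have hφac : AbsolutelyContinuousOnInterval φ 0 T :=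
      ContDiffOn.absolutelyContinuousOnInterval (hφ.of_le (by simp)).contDiffOn
    have h1 := hφac.integral_mul_deriv_eq_deriv_mul hac
    simp only [hφ0, hφT, zero_mul, sub_zero, zero_sub] at h1
    have h2 : ∫ t in (0 : ℝ)..T, φ t * deriv (fun t => ∫ s in (0 : ℝ)..t, g s) t
        = ∫ t in (0 : ℝ)..T, φ t * g t := by
      refine intervalIntegral.integral_congr_ae ?_
      filter_upwards [hgi.ae_hasDerivAt_integral] with t ht hmem
      rw [(ht (uIoc_subset_uIcc hmem) 0 left_mem_uIcc).deriv]
    have h3 (ψ : ℝ → ℝ) : ∫ t in (0 : ℝ)..T, ψ t = ∫ t in Ioo 0 T, ψ t := by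
      rw [intervalIntegral.integral_of_le hT.le, integral_Ioc_eq_integral_Ioo]
    rw [h2, h3, h3] at h1
    have h4 := h φ hφ hφc hφs
    simp only [smul_eq_mul] at h4
    have hprod {f : ℝ → ℝ} (hf : IntegrableOn f (Ioo 0 T)) :
        IntegrableOn (fun t => deriv φ t * f t) (Ioo 0 T) := by
      obtain ⟨C, hC⟩ := (hφ.continuous_deriv (by simp)).bounded_above_of_compact_support
        hφc.deriv
      exact hf.bdd_mul (c := C) (hφ.continuous_deriv (by simp)).aestronglyMeasurable
        (Filter.Eventually.of_forall hC)
    simp only [Pi.sub_apply, mul_sub]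
    rw [integral_sub (hprod ha) (hprod hVi), h4, h1, neg_neg, sub_self])
  refine ⟨c, ?_⟩
  filter_upwards [hc] with t ht
  rw [Pi.sub_apply] at ht
  linarith

/-! ### Time averages and compactness for scalar functions of time -/

/-- A closed ball is closed and convex, hence contains the average of values that lie in it. -/
theorem norm_sub_setAverage_le {α : Type*} [MeasurableSpace α] {μ : Measure α} {f : α → ℝ}
    {A : Set α} (h0 : μ A ≠ 0) (hA : μ A ≠ ⊤) (hf : IntegrableOn f A μ) {x C : ℝ}
    (h : ∀ᵐ y ∂(μ.restrict A), ‖x - f y‖ ≤ C) : ‖x - ⨍ y in A, f y ∂μ‖ ≤ C := by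
  have := (convex_closedBall x C).set_average_mem Metric.isClosed_closedBall h0 hA
    (h.mono fun y hy => by rwa [mem_closedBall_iff_norm']) hf
  rwa [mem_closedBall_iff_norm'] at this

/-- The index of the interval of length `δ` that contains `t`. -/
def timeCell (δ : ℝ) (t : ℝ) : ℤ := ⌊t / δ⌋

theorem measurable_timeCell (δ : ℝ) : Measurable (timeCell δ) :=
  (measurable_id.div_const δ).floor

theorem timeCell_preimage {δ : ℝ} (hδ : 0 < δ) (i : ℤ) :
    timeCell δ ⁻¹' {i} = Ico (i * δ) ((i + 1) * δ) := by
  ext t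
  rw [mem_preimage, mem_singleton_iff, timeCell, Int.floor_eq_iff, le_div_iff₀ hδ,
    div_lt_iff₀ hδ, mem_Ico]

theorem timeMeasure_timeCell_le {T δ : ℝ} (hδ : 0 < δ) (i : ℤ) :
    timeMeasure T (timeCell δ ⁻¹' {i}) ≤ ENNReal.ofReal δ := by
  refine (Measure.restrict_apply_le _ _).trans ?_
  rw [timeCell_preimage hδ, Real.volume_Ico]
  gcongr
  linarith

theorem timeMeasure_timeCell_ne_top {T δ : ℝ} (i : ℤ) :
    timeMeasure T (timeCell δ ⁻¹' {i}) ≠ ⊤ := measure_ne_top _ _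

theorem timeCell_mem_Ico {T : ℝ} {N : ℕ} (hN : 0 < N) {t : ℝ} (ht : t ∈ Ioo 0 T) :
    timeCell (T / N) t ∈ Finset.Ico (0 : ℤ) N := by
  have hT : 0 < T := ht.1.trans ht.2
  have hN' : (0 : ℝ) < N := by exact_mod_cast hN
  rw [Finset.mem_Ico, timeCell, Int.floor_nonneg, Int.floor_lt, div_lt_iff₀ (by positivity)]
  refine ⟨div_nonneg ht.1.le (by positivity), ?_⟩
  push_cast
  rw [mul_div_cancel₀ _ hN'.ne']
  exact ht.2

/-- Averaging over `N` intervals of equal length. -/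
def timeAverage (p : ℝ≥0∞) [Fact (1 ≤ p)] (T : ℝ) (N : ℕ) :
    Lp ℝ p (timeMeasure T) →L[ℝ] Lp ℝ p (timeMeasure T) :=
  stepAverage p (measurable_timeCell (T / N)) timeMeasure_timeCell_ne_top (Finset.Ico (0 : ℤ) N)

/-- For `s` and `t` in one cell, `a t - a s` is the integral of `g` between them, and that interval
stays in the cell. The bound is uniform in `s`, so it survives averaging over `s`. -/
theorem enorm_sub_timeAverage_le {p q : ℝ≥0∞} [Fact (1 ≤ p)] [Fact (1 ≤ q)] {T : ℝ} (hT : 0 < T)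
    {N : ℕ} (hN : 0 < N) {a : Lp ℝ p (timeMeasure T)} {g : Lp ℝ q (timeMeasure T)}
    (h : IsWeakTimeDeriv T a g) :
    ∀ᵐ t ∂(timeMeasure T), ‖(a - timeAverage p T N a) t‖ₑ ≤
      ∫⁻ s in timeCell (T / N) ⁻¹' {timeCell (T / N) t}, ‖g s‖ₑ ∂(timeMeasure T) := by
  have hN' : (0 : ℝ) < N := by exact_mod_cast hN
  have hδ : 0 < T / N := by positivity
  have hg : Integrable g (timeMeasure T) := (Lp.memLp g).integrable Fact.out
  obtain ⟨c, hc⟩ := exists_ae_eq_const_add_integral hT ((Lp.memLp a).integrable Fact.out) hg h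
  filter_upwards [Lp.coeFn_sub a (timeAverage p T N a),
    stepAverage_ae_eq (p := p) (measurable_timeCell (T / N)) timeMeasure_timeCell_ne_top
      (Finset.Ico (0 : ℤ) N) a, hc, ae_measure_fiber_ne_zero (timeMeasure T) (timeCell (T / N)),
    ae_restrict_mem measurableSet_Ioo] with t h1 h2 h3 h4 ht
  set A := timeCell (T / N) ⁻¹' {timeCell (T / N) t} with hAdef
  have hAm : MeasurableSet A := measurable_timeCell _ (measurableSet_singleton _)
  have hord : A.OrdConnected := by
    rw [hAdef, timeCell_preimage hδ]; exact ordConnected_Ico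
  have htA : t ∈ A := rfl
  have key : ‖a t - ⨍ s in A, a s ∂(timeMeasure T)‖ ≤ ∫ s in A, ‖g s‖ ∂(timeMeasure T) := by
    refine norm_sub_setAverage_le h4 (measure_ne_top _ _)
      ((Lp.memLp a).integrable Fact.out).integrableOn ?_
    filter_upwards [ae_restrict_of_ae hc, ae_restrict_mem hAm,
      ae_restrict_of_ae (ae_restrict_mem measurableSet_Ioo)] with s hs hsA hsT
    have hint (r : ℝ) (hr : r ∈ Ioo 0 T) : IntervalIntegrable g volume 0 r := by
      rw [intervalIntegrable_iff_integrableOn_Ioo_of_le hr.1.le]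
      exact IntegrableOn.mono_set hg (Ioo_subset_Ioo_right hr.2.le)
    rw [hs, h3, add_sub_add_left_eq_sub, intervalIntegral.integral_interval_sub_left
      (hint t ht) (hint s hsT)]
    refine intervalIntegral.norm_integral_le_integral_norm_uIoc.trans ?_
    rw [Measure.restrict_restrict hAm]
    have hgA : IntegrableOn (fun s => ‖g s‖) (A ∩ Ioo 0 T) :=
      (IntegrableOn.mono_set hg inter_subset_right).norm
    refine setIntegral_mono_set hgA (Filter.Eventually.of_forall fun _ => norm_nonneg _)
      (LE.le.eventuallyLE (uIoc_subset_uIcc.trans (subset_inter ?_ ?_)))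
    · exact hord.uIcc_subset hsA htA
    · exact ordConnected_Ioo.uIcc_subset hsT ht
  have h5 : (a - timeAverage p T N a) t = a t - ⨍ s in A, a s ∂(timeMeasure T) := by
    rw [h1, Pi.sub_apply]
    congr 1
    rw [timeAverage, h2, if_pos (timeCell_mem_Ico hN ht)]
  rw [h5, ← ofReal_norm]
  refine (ENNReal.ofReal_le_ofReal key).trans ?_
  rw [ofReal_integral_norm_eq_lintegral_enorm hg.integrableOn]

/-- By Tonelli, each point `y` contributes `f y` times the measure of its own fiber. -/
theorem lintegral_setLIntegral_fiber_le {α β : Type*} [MeasurableSpace α] {μ : Measure α}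
    [SFinite μ] [MeasurableSpace β] [MeasurableSpace.CountablyGenerated β] [MeasurableEq β]
    {k : α → β} (hk : Measurable k) {f : α → ℝ≥0∞} (hf : Measurable f) {C : ℝ≥0∞}
    (hC : ∀ i, μ (k ⁻¹' {i}) ≤ C) :
    ∫⁻ x, ∫⁻ y in k ⁻¹' {k x}, f y ∂μ ∂μ ≤ C * ∫⁻ y, f y ∂μ := by
  have hS : MeasurableSet {z : α × α | k z.2 = k z.1} :=
    measurableSet_eq_fun (hk.comp measurable_snd) (hk.comp measurable_fst)
  have h1 (x : α) : ∫⁻ y in k ⁻¹' {k x}, f y ∂μ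
      = ∫⁻ y, {z : α × α | k z.2 = k z.1}.indicator (fun z => f z.2) (x, y) ∂μ := by
    have hA : MeasurableSet (k ⁻¹' {k x}) := measurable_prodMk_left (x := x) hS
    rw [← lintegral_indicator hA]
    rfl
  have h3 : AEMeasurable (Function.uncurry fun x y =>
      {z : α × α | k z.2 = k z.1}.indicator (fun z => f z.2) (x, y)) (μ.prod μ) :=
    ((hf.comp measurable_snd).indicator hS).aemeasurable
  simp_rw [h1]
  rw [lintegral_lintegral_swap h3, ← lintegral_const_mul C hf]
  refine lintegral_mono fun y => ?_
  have h2 (x : α) : {z : α × α | k z.2 = k z.1}.indicator (fun z => f z.2) (x, y)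
      = (k ⁻¹' {k y}).indicator (fun _ => f y) x := by
    by_cases hxy : k y = k x
    · rw [indicator_of_mem (show (x, y) ∈ {z : α × α | k z.2 = k z.1} from hxy),
        indicator_of_mem (show x ∈ k ⁻¹' {k y} from hxy.symm)]
    · rw [indicator_of_notMem (show (x, y) ∉ {z : α × α | k z.2 = k z.1} from hxy),
        indicator_of_notMem (show x ∉ k ⁻¹' {k y} from fun h => hxy h.symm)]
  simp_rw [h2]
  refine (lintegral_indicator_const_le _ _).trans ?_
  rw [mul_comm]
  gcongr
  exact hC _

/-- For `p = ⊤`, Hölder on one cell gives `r = 1 - 1 / q`, which is positive precisely because `q ≠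
1`. For finite `p`, the error is bounded by the integral of `|g|` over a cell, which is small on
average over `t`; this gives `r = 1 / p`, and `C` comes from bounding the `L¹` norm of `g` by its
`L^q` norm. -/
theorem norm_sub_timeAverage_le {p q : ℝ≥0∞} [Fact (1 ≤ p)] [Fact (1 ≤ q)]
    (hpq : ¬ (p = ⊤ ∧ q = 1)) {T : ℝ} (hT : 0 < T) :
    ∃ r C : ℝ, 0 < r ∧ 0 ≤ C ∧ ∀ N : ℕ, 0 < N → ∀ (a : Lp ℝ p (timeMeasure T))
      (g : Lp ℝ q (timeMeasure T)), IsWeakTimeDeriv T a g →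
        ‖a - timeAverage p T N a‖ ≤ C * (T / N) ^ r * ‖g‖ := by
  have hfin (c : ℝ) (hc : 0 ≤ c) : ENNReal.ofReal c ^ (1 - 1 / q.toReal) ≠ ⊤ :=
    ENNReal.rpow_ne_top_of_nonneg (one_sub_one_div_toReal_nonneg q) ENNReal.ofReal_ne_top
  rcases eq_or_ne p ⊤ with rfl | hp
  · have hq1 : q ≠ 1 := fun h => hpq ⟨rfl, h⟩
    refine ⟨1 - 1 / q.toReal, 1, ?_, zero_le_one, fun N hN a g h => ?_⟩
    · rcases eq_or_ne q ⊤ with rfl | hq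
      · simp
      · have : 1 < q.toReal := by
          have h1 : 1 < q := lt_of_le_of_ne Fact.out hq1.symm
          simpa using (ENNReal.toReal_lt_toReal ENNReal.one_ne_top hq).2 h1
        rw [sub_pos]
        exact (div_lt_one (by positivity)).2 this
    have hN' : (0 : ℝ) < N := by exact_mod_cast hN
    have hδ : 0 < T / N := by positivity
    have h1 : eLpNorm (a - timeAverage ⊤ T N a : Lp ℝ ⊤ (timeMeasure T)) ⊤ (timeMeasure T)
        ≤ eLpNorm g q (timeMeasure T) * ENNReal.ofReal (T / N) ^ (1 - 1 / q.toReal) := by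
      rw [eLpNorm_exponent_top]
      refine eLpNormEssSup_le_of_ae_enorm_bound ?_
      filter_upwards [enorm_sub_timeAverage_le hT hN h] with t ht
      refine ht.trans ((setLIntegral_enorm_le_of_memLp (Lp.memLp g) _).trans ?_)
      gcongr
      · exact one_sub_one_div_toReal_nonneg q
      · exact timeMeasure_timeCell_le hδ _
    have h2 := ENNReal.toReal_mono (ENNReal.mul_ne_top (Lp.eLpNorm_ne_top g) (hfin _ hδ.le)) h1
    rw [ENNReal.toReal_mul, ← ENNReal.toReal_rpow, ENNReal.toReal_ofReal hδ.le, mul_comm,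
      ← Lp.norm_def, ← Lp.norm_def] at h2
    rwa [one_mul]
  · have hp1 : 1 ≤ p.toReal := by
      simpa using ENNReal.toReal_mono hp (Fact.out : 1 ≤ p)
    have hp0 : 0 < p.toReal := by linarith
    refine ⟨1 / p.toReal, T ^ (1 - 1 / q.toReal), by positivity, by positivity, fun N hN a g h => ?_⟩
    have hN' : (0 : ℝ) < N := by exact_mod_cast hN
    have hδ : 0 < T / N := by positivity
    set M := ∫⁻ s, ‖g s‖ₑ ∂(timeMeasure T) with hM
    have hMle : M ≤ eLpNorm g q (timeMeasure T) * ENNReal.ofReal T ^ (1 - 1 / q.toReal) := by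
      have := setLIntegral_enorm_le_of_memLp (Lp.memLp g) univ
      simpa using this
    have h1 : eLpNorm (a - timeAverage p T N a : Lp ℝ p (timeMeasure T)) p (timeMeasure T)
        ≤ ENNReal.ofReal (T / N) ^ (1 / p.toReal) * M := by
      rw [eLpNorm_eq_lintegral_rpow_enorm_toReal (zero_lt_one.trans_le Fact.out).ne' hp]
      have h2 : ∫⁻ t, ‖(a - timeAverage p T N a : Lp ℝ p (timeMeasure T)) t‖ₑ ^ p.toReal
          ∂(timeMeasure T) ≤ ENNReal.ofReal (T / N) * M ^ p.toReal := by
        calc _ ≤ ∫⁻ t, M ^ (p.toReal - 1) *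
              ∫⁻ s in timeCell (T / N) ⁻¹' {timeCell (T / N) t}, ‖g s‖ₑ ∂(timeMeasure T)
              ∂(timeMeasure T) := by
              refine lintegral_mono_ae ?_
              filter_upwards [enorm_sub_timeAverage_le hT hN h] with t ht
              -- Since `G ≤ M`, one has `G ^ p ≤ M ^ (p - 1) * G`. This is linear in `G`, so that
              -- Tonelli over the fibers applies.
              set G := ∫⁻ s in timeCell (T / N) ⁻¹' {timeCell (T / N) t}, ‖g s‖ₑ ∂(timeMeasure T)
              have hGM : G ≤ M := setLIntegral_le_lintegral _ _
              calc _ ≤ G ^ p.toReal := by gcongr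
                _ = G ^ (p.toReal - 1) * G ^ (1 : ℝ) := by
                  rw [← ENNReal.rpow_add_of_nonneg _ _ (by linarith) zero_le_one, sub_add_cancel]
                _ ≤ _ := by
                  rw [ENNReal.rpow_one]
                  gcongr
          _ ≤ M ^ (p.toReal - 1) * (ENNReal.ofReal (T / N) * M) := by
              rw [lintegral_const_mul' _ _ (ENNReal.rpow_ne_top_of_nonneg (by linarith) ?_)]
              · gcongr
                exact lintegral_setLIntegral_fiber_le (measurable_timeCell _)
                  (Lp.stronglyMeasurable g).measurable.enorm (timeMeasure_timeCell_le hδ)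
              · exact ne_top_of_le_ne_top
                  (ENNReal.mul_ne_top (Lp.eLpNorm_ne_top g) (hfin _ hT.le)) hMle
          _ = ENNReal.ofReal (T / N) * (M ^ (p.toReal - 1) * M ^ (1 : ℝ)) := by
              rw [ENNReal.rpow_one]; ring
          _ = _ := by
              rw [← ENNReal.rpow_add_of_nonneg _ _ (by linarith) zero_le_one, sub_add_cancel]
      calc _ ≤ (ENNReal.ofReal (T / N) * M ^ p.toReal) ^ (1 / p.toReal) := by gcongr
        _ = _ := by
          rw [ENNReal.mul_rpow_of_nonneg _ _ (by positivity), ← ENNReal.rpow_mul,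
            mul_one_div_cancel hp0.ne', ENNReal.rpow_one]
    have h3 := h1.trans (mul_le_mul_right hMle _)
    have h2 := ENNReal.toReal_mono (ENNReal.mul_ne_top
      (ENNReal.rpow_ne_top_of_nonneg (by positivity) ENNReal.ofReal_ne_top)
      (ENNReal.mul_ne_top (Lp.eLpNorm_ne_top g) (hfin _ hT.le))) h3
    rw [ENNReal.toReal_mul, ENNReal.toReal_mul, ← ENNReal.toReal_rpow, ← ENNReal.toReal_rpow,
      ENNReal.toReal_ofReal hδ.le, ENNReal.toReal_ofReal hT.le, ← Lp.norm_def,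
      ← Lp.norm_def] at h2
    linarith

/-- A bounded family of scalar functions in `L^p(0,T)` that has bounded weak derivatives in
`L^q(0,T)` is given by a compact operator. -/
theorem isCompactOperator_of_isWeakTimeDeriv {E : Type*} [NormedAddCommGroup E] [NormedSpace ℝ E]
    {p q : ℝ≥0∞} [Fact (1 ≤ p)] [Fact (1 ≤ q)] (hpq : ¬ (p = ⊤ ∧ q = 1)) {T : ℝ} (hT : 0 < T)
    (A : E →L[ℝ] Lp ℝ p (timeMeasure T)) (G : E →L[ℝ] Lp ℝ q (timeMeasure T))
    (h : ∀ u, IsWeakTimeDeriv T (A u) (G u)) : IsCompactOperator A := by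
  refine isCompactOperator_of_forall_norm_sub_le A fun ε hε => ?_
  obtain ⟨r, C, hr, hC, hle⟩ := norm_sub_timeAverage_le hpq hT
  have hlim : Filter.Tendsto (fun N : ℕ => C * (T / N) ^ r * ‖G‖) Filter.atTop (nhds 0) := by
    have h1 : Filter.Tendsto (fun N : ℕ => (T / N) ^ r) Filter.atTop (nhds 0) := by
      have h2 := (tendsto_const_div_atTop_nhds_zero_nat T).rpow_const (Or.inr hr.le)
      rwa [Real.zero_rpow hr.ne'] at h2
    simpa using (h1.const_mul C).mul_const ‖G‖
  obtain ⟨N, hN, hN0⟩ := ((hlim.eventually_lt_const hε).and (Filter.eventually_gt_atTop 0)).exists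
  -- The averages have finite rank, and the error is controlled by the bound on `G` alone.
  refine ⟨timeAverage p T N ∘L A, ?_, fun u => ?_⟩
  · exact IsCompactOperator.comp_clm (isCompactOperator_stepAverage _ _ _) A
  · refine (hle N hN0 (A u) (G u) (h u)).trans ?_
    calc _ ≤ C * (T / N) ^ r * (‖G‖ * ‖u‖) := by gcongr; exact G.le_opNorm u
      _ = C * (T / N) ^ r * ‖G‖ * ‖u‖ := by ring
      _ ≤ _ := by gcongr

/-! ### The Aubin–Lions–Simon lemma with values in a Hilbert space -/

section Evolution

variable {X Y B : Type*} [NormedAddCommGroup X] [NormedSpace ℝ X]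
  [NormedAddCommGroup Y] [NormedSpace ℝ Y]

/-- Continuous functionals commute with the Bochner integral. -/
theorem IsWeakTimeDeriv.clm_comp [CompleteSpace Y] {q : ℝ≥0∞} [Fact (1 ≤ q)] {T : ℝ}
    {w : Lp Y q (timeMeasure T)} {g : Lp Y q (timeMeasure T)} (h : IsWeakTimeDeriv T w g)
    (l : Y →L[ℝ] ℝ) {a b : ℝ → ℝ} (ha : ∀ᵐ t ∂(timeMeasure T), a t = l (w t))
    (hb : ∀ᵐ t ∂(timeMeasure T), b t = l (g t)) : IsWeakTimeDeriv T a b := by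
  intro φ hφ hc hs
  have h1 (ψ : ℝ → ℝ) (hψ : Continuous ψ) (hψc : HasCompactSupport ψ)
      (f : Lp Y q (timeMeasure T)) {c : ℝ → ℝ} (hc : ∀ᵐ t ∂(timeMeasure T), c t = l (f t)) :
      ∫ t in Ioo 0 T, ψ t • c t = l (∫ t in Ioo 0 T, ψ t • f t) := by
    rw [← l.integral_comp_comm (integrable_smul_time f hψ hψc)]
    refine integral_congr_ae ?_
    filter_upwards [hc] with t ht
    rw [map_smul, ht]
  rw [h1 _ (hφ.continuous_deriv (by simp)) hc.deriv w ha, h1 _ hφ.continuous hc g hb,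
    h φ hφ hc hs, map_neg]

theorem IsWeakTimeDeriv.eq_zero [CompleteSpace Y] {q : ℝ≥0∞} [Fact (1 ≤ q)] {T : ℝ} {w : ℝ → Y}
    {g : Lp Y q (timeMeasure T)} (h : IsWeakTimeDeriv T w g)
    (hw : ∀ᵐ t ∂(timeMeasure T), w t = 0) : g = 0 := by
  have hg : IntegrableOn g (Ioo 0 T) := (Lp.memLp g).integrable Fact.out
  have hzero (φ : ℝ → ℝ) (hφ : ContDiff ℝ ∞ φ) (hc : HasCompactSupport φ)
      (hs : tsupport φ ⊆ Ioo 0 T) : ∫ t, φ t • g t = 0 := by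
    have h1 := h φ hφ hc hs
    have h2 : ∫ t in Ioo 0 T, deriv φ t • w t = 0 := by
      refine integral_eq_zero_of_ae ?_
      filter_upwards [hw] with t ht
      rw [ht, smul_zero, Pi.zero_apply]
    rw [h2, eq_comm, neg_eq_zero] at h1
    rw [← h1]
    exact (setIntegral_eq_integral_of_forall_compl_eq_zero fun t ht => by
      rw [image_eq_zero_of_notMem_tsupport fun h => ht (hs h), zero_smul]).symm
  have key := isOpen_Ioo.ae_eq_zero_of_integral_contDiff_smul_eq_zero hg.locallyIntegrableOn hzero
  refine Lp.ext ?_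
  filter_upwards [ae_restrict_of_ae key, ae_restrict_mem measurableSet_Ioo,
    Lp.coeFn_zero Y q (timeMeasure T)] with t h1 h2 h3
  rw [h1 h2, h3, Pi.zero_apply]

variable {p q : ℝ≥0∞} [Fact (1 ≤ p)] [Fact (1 ≤ q)] {T : ℝ}

/-- An element records `u`, its copy in `Y` and the weak derivative of that copy. The first
determines the second through `ι`, and the third by uniqueness of weak derivatives. -/
theorem evolutionEmbedding_injective [CompleteSpace Y] [NormedAddCommGroup B] [NormedSpace ℝ B] (ι : X →L[ℝ] Y)
    {j : X →L[ℝ] B} (hj : Function.Injective j) :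
    Function.Injective (evolutionEmbedding p q T ι j) := by
  rw [injective_iff_map_eq_zero]
  intro u hu
  have h0 : ∀ᵐ t ∂(timeMeasure T), u.1.1 t = 0 := by
    filter_upwards [evolutionEmbedding_apply (j := j) u, Lp.coeFn_zero B p (timeMeasure T)] with t h1 h2
    rw [hu, h2, Pi.zero_apply] at h1
    exact hj (by rw [← h1, map_zero])
  have h1 : u.1.1 = 0 := by
    refine Lp.ext ?_
    filter_upwards [h0, Lp.coeFn_zero X p (timeMeasure T)] with t h1 h2
    rw [h1, h2, Pi.zero_apply]
  have hw : ∀ᵐ t ∂(timeMeasure T), u.1.2.1.1 t = 0 := by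
    have := u.2
    filter_upwards [h0, this] with t h2 h3
    rw [h3, h2, map_zero]
  have h2 : u.1.2.1.1 = 0 := by
    refine Lp.ext ?_
    filter_upwards [hw, Lp.coeFn_zero Y q (timeMeasure T)] with t h1 h2
    rw [h1, h2, Pi.zero_apply]
  have h3 : u.1.2.1.2 = 0 := IsWeakTimeDeriv.eq_zero u.1.2.2 hw
  exact Subtype.ext (Prod.ext h1 (Subtype.ext (Prod.ext h2 h3)))

theorem sum_compLpL {ι : Type*} [NormedAddCommGroup B] [NormedSpace ℝ B] (s : Finset ι)
    (F : ι → X →L[ℝ] B) (μ : Measure ℝ) :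
    (∑ i ∈ s, F i).compLpL p μ = ∑ i ∈ s, (F i).compLpL p μ := by
  classical
  induction s using Finset.induction_on with
  | empty =>
    ext1 f
    refine Lp.ext ?_
    simp only [Finset.sum_empty]
    filter_upwards [(0 : X →L[ℝ] B).coeFn_compLpL (p := p) f, Lp.coeFn_zero B p μ] with t h1 h2
    rw [h1, zero_apply, zero_apply, h2, Pi.zero_apply]
  | insert a s ha ih =>
    rw [Finset.sum_insert ha, Finset.sum_insert ha, ContinuousLinearMap.add_compLpL, ih]

/-- The Aubin–Lions–Simon lemma for a space `E` of functions, with values in a Hilbert space `B`;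
that `B` embeds in `Y` is expressed by the existence of sufficiently many functionals on `Y`. -/
theorem isCompactOperator_compLpL_comp [CompleteSpace Y] {E : Type*} [NormedAddCommGroup E] [NormedSpace ℝ E]
    [NormedAddCommGroup B] [InnerProductSpace ℝ B]
    [CompleteSpace B] (hpq : ¬ (p = ⊤ ∧ q = 1)) (hT : 0 < T) (ι : X →L[ℝ] Y) {j : X →L[ℝ] B}
    (hj : IsCompactOperator j) {D : Set B} (hD : Dense D)
    (hι : ∀ φ ∈ D, ∃ l : Y →L[ℝ] ℝ, ∀ x, l (ι x) = inner ℝ φ (j x))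
    (E₁ : E →L[ℝ] Lp X p (timeMeasure T)) (W : E → Lp Y q (timeMeasure T))
    (E₂ : E →L[ℝ] Lp Y q (timeMeasure T))
    (hW : ∀ u, ∀ᵐ t ∂(timeMeasure T), W u t = ι (E₁ u t))
    (hE : ∀ u, IsWeakTimeDeriv T (W u) (E₂ u)) :
    IsCompactOperator (j.compLpL p (timeMeasure T) ∘L E₁) := by
  refine isCompactOperator_of_forall_norm_sub_le _ fun ε hε => ?_
  obtain ⟨n, φ, e, hφ, hle⟩ := exists_finite_rank_approx j hj hD
    (show 0 < ε / (‖E₁‖ + 1) by positivity)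
  let F : X →L[ℝ] B := ∑ i, (innerSL ℝ (φ i) ∘L j).smulRight (e i)
  refine ⟨F.compLpL p (timeMeasure T) ∘L E₁, ?_, fun u => ?_⟩
  · have hF : F.compLpL p (timeMeasure T) ∘L E₁ =
        ∑ i, (ContinuousLinearMap.toSpanSingleton ℝ (e i)).compLpL p (timeMeasure T) ∘L
          ((innerSL ℝ (φ i) ∘L j).compLpL p (timeMeasure T) ∘L E₁) := by
      ext1 u
      rw [ContinuousLinearMap.comp_apply, sum_compLpL, sum_apply, sum_apply]
      refine Finset.sum_congr rfl fun i _ => Lp.ext ?_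
      filter_upwards [((innerSL ℝ (φ i) ∘L j).smulRight (e i)).coeFn_compLpL (p := p) (E₁ u),
        (innerSL ℝ (φ i) ∘L j).coeFn_compLpL (p := p) (E₁ u),
        (ContinuousLinearMap.toSpanSingleton ℝ (e i)).coeFn_compLpL (p := p)
          ((innerSL ℝ (φ i) ∘L j).compLpL p (timeMeasure T) (E₁ u))] with t h1 h2 h3
      rw [h1, ContinuousLinearMap.comp_apply, ContinuousLinearMap.comp_apply, h3, h2]
      rfl
    rw [hF]
    refine isCompactOperator_sum _ _ fun i _ => ?_
    obtain ⟨l, hl⟩ := hι _ (hφ i)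
    have hA : IsCompactOperator ((innerSL ℝ (φ i) ∘L j).compLpL p (timeMeasure T) ∘L E₁) := by
      -- Since `⟨φ i, j ·⟩` factors through `ι` as `l`, the scalar function has the weak derivative
      -- `l ∘ E₂ u` in `L^q`.
      refine isCompactOperator_of_isWeakTimeDeriv hpq hT _ (l.compLpL q (timeMeasure T) ∘L E₂)
        fun u => ?_
      refine IsWeakTimeDeriv.clm_comp (hE u) l ?_ (l.coeFn_compLpL (E₂ u))
      filter_upwards [(innerSL ℝ (φ i) ∘L j).coeFn_compLpL (p := p) (E₁ u), hW u] with t h1 h2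
      rw [ContinuousLinearMap.comp_apply, h1, h2, hl]
      rfl
    exact hA.clm_comp
      ((ContinuousLinearMap.toSpanSingleton ℝ (e i)).compLpL p (timeMeasure T))
  · have h1 : (j.compLpL p (timeMeasure T) ∘L E₁) u - (F.compLpL p (timeMeasure T) ∘L E₁) u
        = (j - F).compLpL p (timeMeasure T) (E₁ u) := by
      have h := ContinuousLinearMap.add_compLpL (p := p) (μ := timeMeasure T) (j - F) F
      rw [sub_add_cancel] at h
      rw [sub_eq_iff_eq_add]
      exact congrArg (fun L : Lp X p (timeMeasure T) →L[ℝ] Lp B p (timeMeasure T) => L (E₁ u)) h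
    rw [h1]
    have h2 : ‖j - F‖ ≤ ε / (‖E₁‖ + 1) :=
      ContinuousLinearMap.opNorm_le_bound _ (by positivity) fun x => by
        have := hle x
        simpa [F] using this
    calc _ ≤ ‖j - F‖ * ‖E₁ u‖ := ContinuousLinearMap.le_of_opNorm_le _
          (ContinuousLinearMap.norm_compLpL_le _) _
      _ ≤ ε / (‖E₁‖ + 1) * ((‖E₁‖ + 1) * ‖u‖) := by
          gcongr
          exact (E₁.le_opNorm u).trans (by gcongr; linarith)
      _ = ε * ‖u‖ := by field_simp

/-- The projection `L^p(0,T;X) ∩ W^{1,q}(0,T;Y) → L^p(0,T;X)`. -/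
def EvolutionSpace.toLp (ι : X →L[ℝ] Y) :
    EvolutionSpace p q T ι →L[ℝ] Lp X p (timeMeasure T) :=
  ContinuousLinearMap.fst ℝ (Lp X p (timeMeasure T)) (SobolevTime q T Y) ∘L
    (EvolutionSpace p q T ι).subtypeL

/-- The weak time derivative `L^p(0,T;X) ∩ W^{1,q}(0,T;Y) → L^q(0,T;Y)`. -/
def EvolutionSpace.timeDeriv (ι : X →L[ℝ] Y) :
    EvolutionSpace p q T ι →L[ℝ] Lp Y q (timeMeasure T) :=
  ContinuousLinearMap.snd ℝ (Lp Y q (timeMeasure T)) (Lp Y q (timeMeasure T)) ∘L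
    (SobolevTime q T Y).subtypeL ∘L
    ContinuousLinearMap.snd ℝ (Lp X p (timeMeasure T)) (SobolevTime q T Y) ∘L
    (EvolutionSpace p q T ι).subtypeL

theorem EvolutionSpace.ae_eq_toLp {ι : X →L[ℝ] Y} (u : EvolutionSpace p q T ι) :
    ∀ᵐ t ∂(timeMeasure T), u.1.2.1.1 t = ι (toLp ι u t) := u.2

theorem EvolutionSpace.isWeakTimeDeriv {ι : X →L[ℝ] Y} (u : EvolutionSpace p q T ι) :
    IsWeakTimeDeriv T u.1.2.1.1 (timeDeriv ι u) := u.1.2.2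

theorem evolutionEmbedding_eq [NormedAddCommGroup B] [NormedSpace ℝ B] (ι : X →L[ℝ] Y)
    (j : X →L[ℝ] B) : evolutionEmbedding p q T ι j =
      j.compLpL p (timeMeasure T) ∘L EvolutionSpace.toLp ι := rfl

/-- The Aubin–Lions–Simon lemma, with values in a Hilbert space `B`; that `B` embeds in `Y` is
expressed by the existence of sufficiently many functionals on `Y`. -/
theorem isCompactOperator_evolutionEmbedding [CompleteSpace Y] [NormedAddCommGroup B]
    [InnerProductSpace ℝ B]
    [CompleteSpace B] (hpq : ¬ (p = ⊤ ∧ q = 1)) (hT : 0 < T) (ι : X →L[ℝ] Y) {j : X →L[ℝ] B}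
    (hj : IsCompactOperator j) {D : Set B} (hD : Dense D)
    (hι : ∀ φ ∈ D, ∃ l : Y →L[ℝ] ℝ, ∀ x, l (ι x) = inner ℝ φ (j x)) :
    IsCompactOperator (evolutionEmbedding p q T ι j) := by
  rw [evolutionEmbedding_eq]
  have h := isCompactOperator_compLpL_comp (p := p) (q := q) hpq hT ι hj hD hι
    (E := EvolutionSpace p q T ι)
  have h := h (EvolutionSpace.toLp ι) (fun u => u.1.2.1.1) (EvolutionSpace.timeDeriv ι)
  exact h EvolutionSpace.ae_eq_toLp EvolutionSpace.isWeakTimeDeriv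

end Evolution

/-! ### Density of `Hs` in `L2`, injectivity, and reduction to the spatial embedding -/

/-- Smooth compactly supported functions are dense in `L²`; being Schwartz functions, they have a
Bessel potential in `L²` for every order `s`. -/
theorem dense_range_Hs_fst (d : ℕ) (s : ℝ) : Dense {f : L2 d | ∃ u : Hs d s, u.1.1 = f} := by
  refine (Lp.dense_hasCompactSupport_contDiff (F := ℝ) (p := 2)
    (μ := (volume : Measure (EuclideanSpace ℝ (Fin d)))) (by simp)).mono ?_
  rintro f ⟨g, hfg, hc, hg⟩
  let G : 𝓢(EuclideanSpace ℝ (Fin d), ℂ) :=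
    HasCompactSupport.toSchwartzMap (f := fun x => (g x : ℂ))
      (hc.comp_left (g := Complex.ofReal) rfl) (Complex.ofRealCLM.contDiff.comp hg)
  have h1 : complexify d f = G.toLp 2 := by
    refine Lp.ext ?_
    filter_upwards [Complex.ofRealCLM.coeFn_compLpL (p := 2)
      (μ := (volume : Measure (EuclideanSpace ℝ (Fin d)))) f, G.coeFn_toLp 2, hfg] with x h1 h2 h3
    rw [complexify, h1, h2, h3]
    rfl
  obtain ⟨w, hw⟩ := G.memSobolev (s := s) (p := 2)
  refine ⟨⟨(f, w), ?_⟩, rfl⟩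
  change TemperedDistribution.besselPotential (EuclideanSpace ℝ (Fin d)) ℂ s
    (Lp.toTemperedDistribution (complexify d f)) = Lp.toTemperedDistribution w
  rw [h1, Lp.toTemperedDistribution_toLp_eq]
  exact hw

theorem IsWeakGradient.eq_zero {d : ℕ} {f : EuclideanSpace ℝ (Fin d) → ℝ} {g : L2Vec d}
    (h : IsWeakGradient f g) (hf : f =ᵐ[volume] 0) : g = 0 := by
  have key (i : Fin d) : ∀ᵐ x, g x i = 0 := by
    refine ae_eq_zero_of_integral_contDiff_smul_eq_zero
      ((memLp_coord g i).locallyIntegrable (by norm_num)) fun φ hφ hc => ?_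
    have h1 := h φ hφ hc i
    have h2 : ∫ x, f x * fderiv ℝ φ x (EuclideanSpace.single i 1) = 0 := by
      refine integral_eq_zero_of_ae ?_
      filter_upwards [hf] with x hx
      simp only [hx, Pi.zero_apply, zero_mul]
    rw [h2, eq_comm, neg_eq_zero] at h1
    simpa only [smul_eq_mul, mul_comm] using h1
  refine Lp.ext ?_
  filter_upwards [ae_all_iff.2 key, Lp.coeFn_zero (EuclideanSpace ℝ (Fin d)) 2 volume] with x h1 h2
  rw [h2]
  ext i
  exact h1 i

/-- The gradient is determined by the function, and so is the weighted component, because the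
weighted measure is absolutely continuous. -/
theorem weightedH1ToL2_injective (d : ℕ) : Function.Injective (weightedH1ToL2 d) := by
  rw [injective_iff_map_eq_zero]
  intro u hu
  have hf : u.1.1.1.1 = 0 := hu
  have hf' : u.1.1.1.1 =ᵐ[volume] (0 : EuclideanSpace ℝ (Fin d) → ℝ) := by
    rw [hf]; exact Lp.coeFn_zero ℝ 2 volume
  have hg : u.1.1.1.2 = 0 := IsWeakGradient.eq_zero u.1.1.2 hf'
  have hw : u.1.2 = 0 := by
    refine Lp.ext ?_
    have := u.2
    filter_upwards [(weightedMeasure_absolutelyContinuous d).ae_le hf', this,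
      Lp.coeFn_zero ℝ 2 (weightedMeasure d)] with x h1 h2 h3
    rw [h2, h1, h3]
  exact Subtype.ext (Prod.ext (Subtype.ext (Prod.ext hf hg)) hw)

instance (d : ℕ) (s : ℝ) : CompleteSpace (HNeg d s) :=
  inferInstanceAs (CompleteSpace (StrongDual ℝ (Hs d s)))

theorem aubinLionsEmbedding_injective (d : ℕ) (p q : ℝ≥0∞) [Fact (1 ≤ p)] [Fact (1 ≤ q)]
    (T k : ℝ) : Function.Injective (aubinLionsEmbedding d p q T k) :=
  evolutionEmbedding_injective _ (weightedH1ToL2_injective d)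

theorem isCompactOperator_aubinLionsEmbedding (d : ℕ) (p q : ℝ≥0∞) [Fact (1 ≤ p)]
    [Fact (1 ≤ q)] (hpq : ¬ (p = ⊤ ∧ q = 1)) {T : ℝ} (hT : 0 < T) (k : ℝ)
    (h : IsCompactOperator (weightedH1ToL2 d)) :
    IsCompactOperator (aubinLionsEmbedding d p q T k) := by
  refine isCompactOperator_evolutionEmbedding hpq hT _ h (dense_range_Hs_fst d k) ?_
  rintro _ ⟨φ, rfl⟩
  -- The required functional on the dual of `Hs d k` is evaluation at `φ`; on the image of `L²` it
  -- is the `L²` inner product with `φ`.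
  refine ⟨(ContinuousLinearMap.apply ℝ ℝ φ : StrongDual ℝ (Hs d k) →L[ℝ] ℝ), fun x => ?_⟩
  refine (l2ToHNeg_apply d k (weightedH1ToL2 d x) φ).trans ?_
  rw [L2.inner_def]
  rfl

/-! ### Square integrals and averages -/

/-- `c` minus the average is the average of `c - f`, to which Cauchy–Schwarz applies. -/
theorem enorm_sub_setAverage_sq_le {α : Type*} [MeasurableSpace α] {μ : Measure α} {f : α → ℝ}
    {A : Set α} (h0 : μ A ≠ 0) (hA : μ A ≠ ⊤) (hf : IntegrableOn f A μ) (c : ℝ) :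
    ‖c - ⨍ y in A, f y ∂μ‖ₑ ^ 2 ≤ (μ A)⁻¹ * ∫⁻ y in A, ‖c - f y‖ₑ ^ 2 ∂μ := by
  have : IsFiniteMeasure (μ.restrict A) := ⟨by simpa using hA.lt_top⟩
  have hr : 0 < μ.real A := ENNReal.toReal_pos h0 hA
  have h1 : c - ⨍ y in A, f y ∂μ = (μ.real A)⁻¹ * ∫ y in A, (c - f y) ∂μ := by
    rw [integral_sub (integrable_const c) hf, setAverage_eq, integral_const, smul_eq_mul,
      smul_eq_mul, measureReal_restrict_apply_univ]
    field_simp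
  have h2 : ‖(μ.real A)⁻¹‖ₑ = (μ A)⁻¹ := by
    rw [Real.enorm_of_nonneg (by positivity), ENNReal.ofReal_inv_of_pos hr, Measure.real,
      ENNReal.ofReal_toReal hA]
  have h3 : ‖∫ y in A, (c - f y) ∂μ‖ₑ ^ 2 ≤ (∫⁻ y in A, ‖c - f y‖ₑ ^ 2 ∂μ) * μ A := by
    have h4 : AEStronglyMeasurable (fun y => c - f y) (μ.restrict A) :=
      aestronglyMeasurable_const.sub hf.aestronglyMeasurable
    have h5 := eLpNorm_le_eLpNorm_mul_rpow_measure_univ (p := 1) (q := 2) (by norm_num) h4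
    rw [eLpNorm_one_eq_lintegral_enorm, Measure.restrict_apply_univ] at h5
    have h6 : eLpNorm (fun y => c - f y) 2 (μ.restrict A) ^ 2
        = ∫⁻ y in A, ‖c - f y‖ₑ ^ 2 ∂μ := by
      have := eLpNorm_nnreal_pow_eq_lintegral (f := fun y => c - f y) (μ := μ.restrict A)
        (p := 2) (by norm_num)
      simpa using this
    have h7 : (μ A ^ (1 / (1 : ℝ≥0∞).toReal - 1 / (2 : ℝ≥0∞).toReal)) ^ 2 = μ A := by
      rw [← ENNReal.rpow_natCast, ← ENNReal.rpow_mul]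
      norm_num
    calc _ ≤ (∫⁻ y in A, ‖c - f y‖ₑ ∂μ) ^ 2 := by
          gcongr
          exact enorm_integral_le_lintegral_enorm _
      _ ≤ _ := pow_le_pow_left' h5 2
      _ = _ := by rw [mul_pow, h6, h7]
  rw [h1, enorm_mul, mul_pow, h2]
  calc _ ≤ (μ A)⁻¹ ^ 2 * ((∫⁻ y in A, ‖c - f y‖ₑ ^ 2 ∂μ) * μ A) := by gcongr
    _ = (μ A)⁻¹ * ((μ A)⁻¹ * μ A) * ∫⁻ y in A, ‖c - f y‖ₑ ^ 2 ∂μ := by ring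
    _ = _ := by rw [ENNReal.inv_mul_cancel h0 hA, mul_one]

theorem enorm_sq_eq_lintegral {α F : Type*} [MeasurableSpace α] {μ : Measure α}
    [NormedAddCommGroup F] (f : Lp F 2 μ) : ‖f‖ₑ ^ 2 = ∫⁻ x, ‖f x‖ₑ ^ 2 ∂μ := by
  rw [Lp.enorm_def]
  simpa using eLpNorm_nnreal_pow_eq_lintegral (f := f) (μ := μ) (p := 2) (by norm_num)

/-! ### Translation estimate for functions with a weak gradient -/

section Translation

variable {d : ℕ}

theorem sum_smul_single (v : EuclideanSpace ℝ (Fin d)) :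
    ∑ i, v i • EuclideanSpace.single i (1 : ℝ) = v := by
  simpa using (EuclideanSpace.basisFun (Fin d) ℝ).sum_repr v

theorem IsWeakGradient.integral_mul_fderiv {f : L2 d} {g : L2Vec d} (h : IsWeakGradient f g)
    {φ : EuclideanSpace ℝ (Fin d) → ℝ} (hφ : ContDiff ℝ ∞ φ) (hc : HasCompactSupport φ)
    (v : EuclideanSpace ℝ (Fin d)) :
    ∫ x, f x * fderiv ℝ φ x v = -∫ x, inner ℝ v (g x) * φ x := by
  have h1 : ∀ x, f x * fderiv ℝ φ x v
      = ∑ i, v i * (f x * fderiv ℝ φ x (EuclideanSpace.single i 1)) := fun x => by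
    conv_lhs => rw [← sum_smul_single v, map_sum, Finset.mul_sum]
    refine Finset.sum_congr rfl fun i _ => ?_
    rw [map_smul, smul_eq_mul]; ring
  have h2 : ∀ x, inner ℝ v (g x) * φ x = ∑ i, v i * (g x i * φ x) := fun x => by
    rw [PiLp.inner_apply, Finset.sum_mul]
    refine Finset.sum_congr rfl fun i _ => ?_
    simp only [RCLike.inner_apply, conj_trivial]; ring
  simp_rw [h1, h2]
  rw [integral_finsetSum _ fun i _ => (integrable_mul_of_continuous (Lp.memLp f)
      (continuous_partial hφ _) (hc.fderiv_apply ℝ _)).const_mul _,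
    integral_finsetSum _ fun i _ => (integrable_mul_of_continuous (memLp_coord g i)
      hφ.continuous hc).const_mul _, ← Finset.sum_neg_distrib]
  refine Finset.sum_congr rfl fun i _ => ?_
  rw [integral_const_mul, integral_const_mul, h φ hφ hc i, mul_neg]

theorem norm_integral_inner_mul_le (g : L2Vec d) (v : EuclideanSpace ℝ (Fin d)) (φ : L2 d) :
    ‖∫ x, inner ℝ v (g x) * φ x‖ ≤ ‖v‖ * ‖g‖ * ‖φ‖ := by
  let gv : L2 d := (innerSL ℝ v).compLpL 2 volume g
  have h1 : ∫ x, inner ℝ v (g x) * φ x = inner ℝ φ gv := by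
    rw [L2.inner_def]
    refine integral_congr_ae ?_
    filter_upwards [(innerSL ℝ v).coeFn_compLpL (p := 2) g] with x hx
    rw [hx]
    simp
  rw [h1]
  refine (norm_inner_le_norm _ _).trans ?_
  rw [mul_comm]
  gcongr
  refine (ContinuousLinearMap.le_of_opNorm_le _ (ContinuousLinearMap.norm_compLpL_le _) g).trans ?_
  rw [innerSL_apply_norm]

/-- `x ↦ f (x + h)`. -/
def translate (h : EuclideanSpace ℝ (Fin d)) (f : L2 d) : L2 d :=
  Lp.compMeasurePreserving (· + h) (measurePreserving_add_right volume h) f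

theorem translate_ae_eq (h : EuclideanSpace ℝ (Fin d)) (f : L2 d) :
    translate h f =ᵐ[volume] fun x => f (x + h) :=
  Lp.coeFn_compMeasurePreserving _ _

/-- As a function of the shift `z`, the integral of `f (x + z) * φ x` is the convolution of `f` with
the reflection of `φ`, hence differentiable. Its derivative falls on `φ` and is moved to `f` by the
weak gradient, so it is bounded by `‖g‖ * ‖φ‖`; the mean value inequality from `0` to `h` concludes.
No smooth approximation of `f` is needed. -/
theorem norm_integral_translate_sub_mul_le {f : L2 d} {g : L2Vec d} (hfg : IsWeakGradient f g)
    (h : EuclideanSpace ℝ (Fin d)) {φ : EuclideanSpace ℝ (Fin d) → ℝ} (hφ : ContDiff ℝ ∞ φ)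
    (hc : HasCompactSupport φ) :
    ‖(∫ x, f (x + h) * φ x) - ∫ x, f x * φ x‖ ≤ ‖h‖ * ‖g‖ * (eLpNorm φ 2 volume).toReal := by
  let ψ : EuclideanSpace ℝ (Fin d) → ℝ := fun y => φ (-y)
  have hψ : ContDiff ℝ ∞ ψ := hφ.comp contDiff_neg
  have hψc : HasCompactSupport ψ := hc.comp_homeomorph (Homeomorph.neg _)
  have hloc : LocallyIntegrable f volume := (Lp.memLp f).locallyIntegrable (by norm_num)
  let c : EuclideanSpace ℝ (Fin d) → ℝ := fun z => ∫ t, f t * ψ (z - t)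
  have hcd (z : EuclideanSpace ℝ (Fin d)) := hψc.hasFDerivAt_convolution_right
    (ContinuousLinearMap.mul ℝ ℝ) hloc (hψ.of_le (by simp)) z
  have hce : (convolution f ψ (ContinuousLinearMap.mul ℝ ℝ) volume) = c := rfl
  rw [hce] at hcd
  have hbound (z : EuclideanSpace ℝ (Fin d)) : ‖(convolution f (fderiv ℝ ψ)
      ((ContinuousLinearMap.mul ℝ ℝ).precompR (EuclideanSpace ℝ (Fin d))) volume) z‖
      ≤ ‖g‖ * (eLpNorm φ 2 volume).toReal := by
    refine ContinuousLinearMap.opNorm_le_bound _ (by positivity) fun v => ?_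
    have hφz : ContDiff ℝ ∞ fun t => φ (t - z) := hφ.comp (contDiff_id.sub contDiff_const)
    have hφzc : HasCompactSupport fun t => φ (t - z) :=
      hc.comp_homeomorph (Homeomorph.subRight z)
    have hmem : MemLp (fun t => φ (t - z)) 2 volume :=
      hφz.continuous.memLp_of_hasCompactSupport hφzc
    let Φ : L2 d := MemLp.toLp _ hmem
    have h1 : (convolution f (fderiv ℝ ψ) ((ContinuousLinearMap.mul ℝ ℝ).precompR
        (EuclideanSpace ℝ (Fin d))) volume) z v
        = ∫ t, inner ℝ v (g t) * Φ t := by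
      rw [convolution_precompR_apply _ hloc (hψc.fderiv ℝ) (hψ.continuous_fderiv (by simp))]
      have h2 : ∀ t, fderiv ℝ ψ (z - t) v = - fderiv ℝ (fun t => φ (t - z)) t v := fun t => by
        have h3 : HasFDerivAt (fun t => ψ (z - t))
            ((fderiv ℝ ψ (z - t)).comp (-ContinuousLinearMap.id ℝ _)) t :=
          ((hψ.differentiable (by simp)) (z - t)).hasFDerivAt.comp t
            ((hasFDerivAt_id t).const_sub z)
        have h4 : (fun t => φ (t - z)) = fun t => ψ (z - t) := by
          funext t; simp only [ψ, neg_sub]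
        rw [h4, h3.fderiv]
        simp
      have h4 := hfg.integral_mul_fderiv hφz hφzc v
      have h5 : ∫ t, inner ℝ v (g t) * Φ t = ∫ t, inner ℝ v (g t) * φ (t - z) := by
        refine integral_congr_ae ?_
        filter_upwards [hmem.coeFn_toLp] with t ht
        rw [ht]
      rw [h5, convolution_def]
      simp only [ContinuousLinearMap.mul_apply', h2, mul_neg]
      rw [integral_neg, h4, neg_neg]
    rw [h1]
    refine (norm_integral_inner_mul_le g v _).trans (le_of_eq ?_)
    rw [Lp.norm_toLp]
    have h6 : eLpNorm (fun t => φ (t - z)) 2 volume = eLpNorm φ 2 volume :=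
      eLpNorm_comp_measurePreserving hφ.continuous.aestronglyMeasurable
        (measurePreserving_sub_right volume z)
    rw [h6]
    ring
  have h1 := convex_univ.norm_image_sub_le_of_norm_hasFDerivWithin_le
    (fun z _ => (hcd z).hasFDerivWithinAt) (fun z _ => hbound z) (mem_univ 0) (mem_univ h)
  have h2 : c h = ∫ x, f (x + h) * φ x := by
    simp only [c]
    rw [← integral_add_right_eq_self (fun t => f t * ψ (h - t)) h]
    refine integral_congr_ae (Filter.Eventually.of_forall fun x => ?_)
    simp [ψ]
  have h3 : c 0 = ∫ x, f x * φ x := by simp [c, ψ]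
  rw [h2, h3, sub_zero] at h1
  linarith

/-- The `L²` modulus of continuity of an `H¹` function. -/
theorem norm_translate_sub_le {f : L2 d} {g : L2Vec d} (hfg : IsWeakGradient f g)
    (h : EuclideanSpace ℝ (Fin d)) : ‖translate h f - f‖ ≤ ‖h‖ * ‖g‖ := by
  set r : L2 d := translate h f - f with hr
  have hdense := Lp.dense_hasCompactSupport_contDiff (F := ℝ) (p := 2)
    (μ := (volume : Measure (EuclideanSpace ℝ (Fin d)))) (by simp)
  have hclosed : IsClosed {φ : L2 d | ‖inner ℝ φ r‖ ≤ ‖h‖ * ‖g‖ * ‖φ‖} :=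
    isClosed_le (by fun_prop) (by fun_prop)
  -- Duality: the bound on the pairing passes from test functions to all of `L²` by density, and is
  -- then applied to `r` itself.
  have key : ∀ φ : L2 d, ‖inner ℝ φ r‖ ≤ ‖h‖ * ‖g‖ * ‖φ‖ := by
    intro φ
    refine hclosed.closure_subset_iff.2 ?_ (hdense φ)
    rintro φ ⟨ψ, hφψ, hc, hψ⟩
    have h1 : inner ℝ φ r = (∫ x, f (x + h) * ψ x) - ∫ x, f x * ψ x := by
      have hmp := measurePreserving_add_right (volume : Measure (EuclideanSpace ℝ (Fin d))) h
      have hint : Integrable fun x => f (x + h) * ψ x := integrable_mul_of_continuous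
        ((Lp.memLp f).comp_measurePreserving hmp) hψ.continuous hc
      rw [L2.inner_def, ← integral_sub hint (integrable_mul_of_continuous (Lp.memLp f) hψ.continuous hc)]
      refine integral_congr_ae ?_
      filter_upwards [hφψ, Lp.coeFn_sub (translate h f) f, translate_ae_eq h f] with x h1 h2 h3
      rw [hr, h1, h2, Pi.sub_apply, h3]
      simp [sub_mul]
    have h2 : ‖φ‖ = (eLpNorm ψ 2 volume).toReal := by
      rw [Lp.norm_def, eLpNorm_congr_ae hφψ]
    change ‖inner ℝ φ r‖ ≤ ‖h‖ * ‖g‖ * ‖φ‖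
    rw [h1, h2]
    exact norm_integral_translate_sub_mul_le hfg h hψ hc
  have h3 := key r
  rw [real_inner_self_eq_norm_sq, norm_pow, norm_norm, sq] at h3
  rcases (norm_nonneg r).eq_or_lt with h0 | h0
  · rw [← h0]; positivity
  · exact le_of_mul_le_mul_right h3 h0

theorem lintegral_enorm_sub_sq_le {f : L2 d} {g : L2Vec d} (hfg : IsWeakGradient f g)
    (h : EuclideanSpace ℝ (Fin d)) :
    ∫⁻ x, ‖f x - f (x + h)‖ₑ ^ 2 ≤ (‖h‖ₑ * ‖g‖ₑ) ^ 2 := by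
  have h1 : ∫⁻ x, ‖f x - f (x + h)‖ₑ ^ 2 = ‖translate h f - f‖ₑ ^ 2 := by
    rw [enorm_sq_eq_lintegral]
    refine lintegral_congr_ae ?_
    filter_upwards [Lp.coeFn_sub (translate h f) f, translate_ae_eq h f] with x h2 h3
    rw [h2, Pi.sub_apply, h3, enorm_sub_rev]
  rw [h1]
  gcongr
  rw [← ofReal_norm, ← ofReal_norm, ← ofReal_norm, ← ENNReal.ofReal_mul (norm_nonneg _)]
  exact ENNReal.ofReal_le_ofReal (norm_translate_sub_le hfg h)

end Translation

/-! ### Averages over cubes and compactness of the weighted embedding -/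

section Grid

variable {d : ℕ}

/-- The index of the cube of side `δ` that contains `x`. -/
def gridCell (δ : ℝ) (x : EuclideanSpace ℝ (Fin d)) : Fin d → ℤ := fun i => ⌊x i / δ⌋

theorem measurable_gridCell (δ : ℝ) : Measurable (gridCell δ : EuclideanSpace ℝ (Fin d) → _) :=
  measurable_pi_lambda _ fun i =>
    (((EuclideanSpace.proj i : EuclideanSpace ℝ (Fin d) →L[ℝ] ℝ).measurable).div_const δ).floor

theorem volume_box (a b : Fin d → ℝ) :
    volume {x : EuclideanSpace ℝ (Fin d) | ∀ i, x i ∈ Ico (a i) (b i)}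
      = ∏ i, ENNReal.ofReal (b i - a i) := by
  have h := (EuclideanSpace.volume_preserving_symm_measurableEquiv_toLp (Fin d)).measure_preimage
    (MeasurableSet.univ_pi fun i => measurableSet_Ico (a := a i) (b := b i)).nullMeasurableSet
  rw [Real.volume_pi_Ico] at h
  rw [← h]
  congr 1
  ext x
  simp [mem_pi]

theorem volume_gridCell {δ : ℝ} (hδ : 0 < δ) (z : Fin d → ℤ) :
    volume (gridCell δ ⁻¹' {z} : Set (EuclideanSpace ℝ (Fin d))) = ENNReal.ofReal δ ^ d := by
  have h : (gridCell δ ⁻¹' {z} : Set (EuclideanSpace ℝ (Fin d)))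
      = {x | ∀ i, x i ∈ Ico (z i * δ) ((z i + 1) * δ)} := by
    ext x
    simp only [mem_preimage, mem_singleton_iff, funext_iff, gridCell, Int.floor_eq_iff,
      le_div_iff₀ hδ, div_lt_iff₀ hδ, mem_Ico, mem_ofPred_eq]
  rw [h, volume_box]
  have (i : Fin d) : ((z i : ℝ) + 1) * δ - z i * δ = δ := by ring
  simp [this]

theorem volume_gridCell_ne_top {δ : ℝ} (hδ : 0 < δ) (z : Fin d → ℤ) :
    volume (gridCell δ ⁻¹' {z} : Set (EuclideanSpace ℝ (Fin d))) ≠ ⊤ := by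
  rw [volume_gridCell hδ]
  exact ENNReal.pow_ne_top ENNReal.ofReal_ne_top

/-- Differences of points of a common cube. -/
def gridBox (d : ℕ) (δ : ℝ) : Set (EuclideanSpace ℝ (Fin d)) := {h | ∀ i, h i ∈ Ico (-δ) δ}

theorem measurableSet_gridBox (δ : ℝ) : MeasurableSet (gridBox d δ) := by
  have : gridBox d δ = ⋂ i, (fun h : EuclideanSpace ℝ (Fin d) => h i) ⁻¹' Ico (-δ) δ := by
    ext h; simp [gridBox]
  rw [this]
  exact MeasurableSet.iInter fun i =>
    (EuclideanSpace.proj i : EuclideanSpace ℝ (Fin d) →L[ℝ] ℝ).measurable measurableSet_Ico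

theorem volume_gridBox (δ : ℝ) : volume (gridBox d δ) = 2 ^ d * ENNReal.ofReal δ ^ d := by
  rw [gridBox, volume_box, ← mul_pow]
  have : δ - -δ = 2 * δ := by ring
  simp [this, ENNReal.ofReal_mul]

theorem sub_mem_gridBox {δ : ℝ} (hδ : 0 < δ) {x y : EuclideanSpace ℝ (Fin d)}
    (h : gridCell δ y = gridCell δ x) : y - x ∈ gridBox d δ := by
  intro i
  have hi : ⌊y i / δ⌋ = ⌊x i / δ⌋ := congrFun h i
  have h1 := abs_lt.1 (Int.abs_sub_lt_one_of_floor_eq_floor hi)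
  rw [← sub_div, lt_div_iff₀ hδ, div_lt_iff₀ hδ] at h1
  simp only [PiLp.sub_apply, mem_Ico]
  constructor <;> linarith [h1.1, h1.2]

theorem enorm_sq_le_of_mem_gridBox {δ : ℝ} {h : EuclideanSpace ℝ (Fin d)} (hh : h ∈ gridBox d δ) :
    ‖h‖ₑ ^ 2 ≤ d * ENNReal.ofReal δ ^ 2 := by
  have h1 : ‖h‖ ^ 2 ≤ d * δ ^ 2 := by
    rw [EuclideanSpace.norm_sq_eq]
    calc _ ≤ ∑ _i : Fin d, δ ^ 2 := by
          refine Finset.sum_le_sum fun i _ => ?_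
          rw [Real.norm_eq_abs, sq_abs]
          have := hh i
          exact sq_le_sq' this.1 this.2.le
      _ = _ := by simp
  by_cases hd : d = 0
  · subst hd
    have : h = 0 := Subsingleton.elim _ _
    simp [this]
  have hδ : 0 ≤ δ := by
    have := hh ⟨0, Nat.pos_of_ne_zero hd⟩
    linarith [this.1, this.2]
  rw [← ofReal_norm, ← ENNReal.ofReal_pow (norm_nonneg _), ← ENNReal.ofReal_pow hδ,
    ← ENNReal.ofReal_natCast d, ← ENNReal.ofReal_mul (by positivity)]
  exact ENNReal.ofReal_le_ofReal h1

/-- A Poincaré inequality, summed over all cubes of a grid. -/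
theorem lintegral_sub_gridAverage_sq_le {δ : ℝ} (hδ : 0 < δ) {f : L2 d} {g : L2Vec d}
    (hfg : IsWeakGradient f g) :
    ∫⁻ x, ‖f x - ⨍ y in gridCell δ ⁻¹' {gridCell δ x}, f y‖ₑ ^ 2
      ≤ 2 ^ d * d * ENNReal.ofReal δ ^ 2 * ‖g‖ₑ ^ 2 := by
  have hfm : Measurable f := (Lp.stronglyMeasurable f).measurable
  have hδ0 : ENNReal.ofReal δ ^ d ≠ 0 := by
    simpa using fun h : δ ≤ 0 => absurd hδ h.not_gt
  have hδt : ENNReal.ofReal δ ^ d ≠ ⊤ := ENNReal.pow_ne_top ENNReal.ofReal_ne_top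
  -- Cauchy–Schwarz on the cube of `x`, then `y = x + h`: every such `h` lies in a box that does not
  -- depend on `x`, which allows Tonelli.
  have hpt (x : EuclideanSpace ℝ (Fin d)) :
      ‖f x - ⨍ y in gridCell δ ⁻¹' {gridCell δ x}, f y‖ₑ ^ 2
        ≤ (ENNReal.ofReal δ ^ d)⁻¹ * ∫⁻ h in gridBox d δ, ‖f x - f (x + h)‖ₑ ^ 2 := by
    have h0 := volume_gridCell hδ (gridCell δ x)
    refine (enorm_sub_setAverage_sq_le (h0 ▸ hδ0) (h0 ▸ hδt)
      (integrableOn_of_Lp f (h0 ▸ hδt)) (f x)).trans ?_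
    rw [h0]
    refine mul_le_mul_right ?_ _
    rw [← lintegral_indicator (measurable_gridCell δ (measurableSet_singleton _)),
      ← lintegral_indicator (measurableSet_gridBox δ), ← lintegral_add_left_eq_self _ x]
    refine lintegral_mono fun h => ?_
    by_cases hh : x + h ∈ gridCell δ ⁻¹' {gridCell δ x}
    · have h1 : h ∈ gridBox d δ := by simpa using sub_mem_gridBox hδ hh
      rw [indicator_of_mem hh, indicator_of_mem h1]
    · rw [indicator_of_notMem hh]
      exact zero_le
  calc _ ≤ ∫⁻ x, (ENNReal.ofReal δ ^ d)⁻¹ * ∫⁻ h in gridBox d δ, ‖f x - f (x + h)‖ₑ ^ 2 :=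
        lintegral_mono hpt
    _ = (ENNReal.ofReal δ ^ d)⁻¹ *
          ∫⁻ h in gridBox d δ, ∫⁻ x, ‖f x - f (x + h)‖ₑ ^ 2 := by
        rw [lintegral_const_mul' _ _ (ENNReal.inv_ne_top.2 hδ0), lintegral_lintegral_swap]
        refine Measurable.aemeasurable ?_
        have : Measurable fun z : EuclideanSpace ℝ (Fin d) × EuclideanSpace ℝ (Fin d) =>
            ‖f z.1 - f (z.1 + z.2)‖ₑ ^ 2 := by fun_prop
        exact this
    _ ≤ (ENNReal.ofReal δ ^ d)⁻¹ *
          ∫⁻ _h in gridBox d δ, d * ENNReal.ofReal δ ^ 2 * ‖g‖ₑ ^ 2 := by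
        refine mul_le_mul_right ?_ _
        refine setLIntegral_mono' (measurableSet_gridBox δ) fun h hh => ?_
        refine (lintegral_enorm_sub_sq_le hfg h).trans ?_
        rw [mul_pow]
        gcongr
        exact enorm_sq_le_of_mem_gridBox hh
    -- The box has side `2 * δ`, twice that of a cube; this is the source of the factor `2 ^ d`.
    _ = (ENNReal.ofReal δ ^ d)⁻¹ * ENNReal.ofReal δ ^ d *
          (2 ^ d * d * ENNReal.ofReal δ ^ 2 * ‖g‖ₑ ^ 2) := by
        rw [setLIntegral_const, volume_gridBox]; ring
    _ = _ := by rw [ENNReal.inv_mul_cancel hδ0 hδt, one_mul]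

/-- The indices of the cubes that cover a ball of radius `N * δ`. -/
def gridIndices (d N : ℕ) : Finset (Fin d → ℤ) :=
  Fintype.piFinset fun _ => Finset.Ico (-(N : ℤ)) N

theorem le_norm_of_gridCell_notMem {δ : ℝ} (hδ : 0 < δ) {N : ℕ} {x : EuclideanSpace ℝ (Fin d)}
    (hx : gridCell δ x ∉ gridIndices d N) : N * δ ≤ ‖x‖ := by
  by_contra! hlt
  refine hx (Fintype.mem_piFinset.2 fun i => ?_)
  have h1 := abs_lt.1 ((PiLp.norm_apply_le x i).trans_lt hlt)
  rw [Finset.mem_Ico, gridCell, Int.le_floor, Int.floor_lt, le_div_iff₀ hδ, div_lt_iff₀ hδ]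
  push_cast
  constructor <;> linarith [h1.1, h1.2]

theorem lintegral_weighted (u : WeightedH1 d) :
    ∫⁻ x, ENNReal.ofReal (‖x‖ ^ 2) * ‖weightedH1ToL2 d u x‖ₑ ^ 2 ≤ ‖u‖ₑ ^ 2 := by
  have hm : Measurable fun x : EuclideanSpace ℝ (Fin d) => ENNReal.ofReal (‖x‖ ^ 2) := by
    fun_prop
  have hfm : Measurable (weightedH1ToL2 d u) :=
    (Lp.stronglyMeasurable (weightedH1ToL2 d u)).measurable
  have h1 : ∫⁻ x, ENNReal.ofReal (‖x‖ ^ 2) * ‖weightedH1ToL2 d u x‖ₑ ^ 2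
      = ∫⁻ x, ‖weightedH1ToL2 d u x‖ₑ ^ 2 ∂(weightedMeasure d) := by
    rw [weightedMeasure, lintegral_withDensity_eq_lintegral_mul _ hm (by fun_prop)]
    rfl
  have h2 : ∫⁻ x, ‖weightedH1ToL2 d u x‖ₑ ^ 2 ∂(weightedMeasure d) = ‖u.1.2‖ₑ ^ 2 := by
    rw [enorm_sq_eq_lintegral]
    refine lintegral_congr_ae ?_
    have hu : (u.1.2 : EuclideanSpace ℝ (Fin d) → ℝ) =ᵐ[weightedMeasure d] u.1.1.1.1 := u.2
    filter_upwards [hu] with x hx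
    rw [hx]
    rfl
  rw [h1, h2]
  gcongr
  rw [← ofReal_norm, ← ofReal_norm]
  exact ENNReal.ofReal_le_ofReal (norm_snd_le u.1)

/-- Averaging over the cubes of side `δ` that cover a ball of radius `N * δ`. -/
def gridAverage (d : ℕ) {δ : ℝ} (hδ : 0 < δ) (N : ℕ) : L2 d →L[ℝ] L2 d :=
  stepAverage 2 (measurable_gridCell δ) (volume_gridCell_ne_top hδ) (gridIndices d N)

/-- On the chosen cubes the Poincaré inequality applies. On the others the averaged function is zero
and `N * δ ≤ ‖x‖`, so the weight controls `f` itself. -/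
theorem enorm_sub_gridAverage_sq_le {δ : ℝ} (hδ : 0 < δ) {N : ℕ} (hN : 0 < N)
    (u : WeightedH1 d) :
    ‖weightedH1ToL2 d u - gridAverage d hδ N (weightedH1ToL2 d u)‖ₑ ^ 2
      ≤ (2 ^ d * d * ENNReal.ofReal δ ^ 2 + ENNReal.ofReal ((N * δ) ^ 2)⁻¹) * ‖u‖ₑ ^ 2 := by
  set f := weightedH1ToL2 d u with hf
  have hN' : (0 : ℝ) < N := by exact_mod_cast hN
  have hfm : Measurable f := (Lp.stronglyMeasurable f).measurable
  have hfg : IsWeakGradient f u.1.1.1.2 := u.1.1.2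
  have hg : ‖u.1.1.1.2‖ₑ ≤ ‖u‖ₑ := by
    rw [← ofReal_norm, ← ofReal_norm]
    exact ENNReal.ofReal_le_ofReal
      ((norm_snd_le u.1.1.1).trans (norm_fst_le u.1))
  rw [enorm_sq_eq_lintegral]
  calc _ ≤ ∫⁻ x, (‖f x - ⨍ y in gridCell δ ⁻¹' {gridCell δ x}, f y‖ₑ ^ 2
        + ENNReal.ofReal ((N * δ) ^ 2)⁻¹ * (ENNReal.ofReal (‖x‖ ^ 2) * ‖f x‖ₑ ^ 2)) := by
        refine lintegral_mono_ae ?_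
        filter_upwards [Lp.coeFn_sub f (gridAverage d hδ N f),
          stepAverage_ae_eq (p := 2) (measurable_gridCell δ) (volume_gridCell_ne_top hδ)
            (gridIndices d N) f] with x h1 h2
        have h3 : (gridAverage d hδ N f) x = _ := h2
        rw [h1, Pi.sub_apply, h3]
        split_ifs with hx
        · exact le_self_add
        · refine le_add_left ?_
          rw [sub_zero, ← mul_assoc, ← ENNReal.ofReal_mul (by positivity)]
          refine le_mul_of_one_le_left zero_le ?_
          rw [ENNReal.one_le_ofReal, ← div_eq_inv_mul, one_le_div (by positivity)]
          have := le_norm_of_gridCell_notMem hδ hx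
          gcongr
    _ = (∫⁻ x, ‖f x - ⨍ y in gridCell δ ⁻¹' {gridCell δ x}, f y‖ₑ ^ 2)
        + ENNReal.ofReal ((N * δ) ^ 2)⁻¹ * ∫⁻ x, ENNReal.ofReal (‖x‖ ^ 2) * ‖f x‖ₑ ^ 2 := by
        rw [lintegral_add_right _ (by fun_prop), lintegral_const_mul _ (by fun_prop)]
    _ ≤ 2 ^ d * d * ENNReal.ofReal δ ^ 2 * ‖u‖ₑ ^ 2
        + ENNReal.ofReal ((N * δ) ^ 2)⁻¹ * ‖u‖ₑ ^ 2 := by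
        refine add_le_add ((lintegral_sub_gridAverage_sq_le hδ hfg).trans ?_) ?_
        · gcongr
        · gcongr
          exact lintegral_weighted u
    _ = _ := by rw [add_mul]

end Grid

/-- The embedding `H¹(ℝᵈ) ∩ L²(ℝᵈ, |v|² dv) → L²(ℝᵈ)` is compact. -/
theorem isCompactOperator_weightedH1ToL2 (d : ℕ) : IsCompactOperator (weightedH1ToL2 d) := by
  refine isCompactOperator_of_forall_norm_sub_le _ fun ε hε => ?_
  -- Cubes of side `1 / n` with `N = n ^ 2` cover a ball of radius `n`, so that the Poincaré term
  -- and the tail term are both of order `1 / n ^ 2`.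
  have hlim : Filter.Tendsto (fun n : ℕ => (2 ^ d * d + 1) * (1 / (n : ℝ)) ^ 2) Filter.atTop
      (nhds 0) := by
    simpa using ((tendsto_const_div_atTop_nhds_zero_nat (1 : ℝ)).pow 2).const_mul
      ((2 : ℝ) ^ d * d + 1)
  obtain ⟨n, hn, hn0⟩ := ((hlim.eventually_lt_const (show 0 < ε ^ 2 by positivity)).and
    (Filter.eventually_gt_atTop 0)).exists
  have hn' : (0 : ℝ) < n := by exact_mod_cast hn0
  have hδ : (0 : ℝ) < 1 / n := by positivity
  refine ⟨gridAverage d hδ (n ^ 2) ∘L weightedH1ToL2 d,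
    IsCompactOperator.comp_clm (isCompactOperator_stepAverage _ _ _) (weightedH1ToL2 d),
    fun u => ?_⟩
  have h1 := enorm_sub_gridAverage_sq_le hδ (pow_pos hn0 2) u
  have h2 : ((((n ^ 2 : ℕ) : ℝ) * (1 / n)) ^ 2)⁻¹ = (1 / (n : ℝ)) ^ 2 := by
    push_cast; field_simp
  have h3 : (2 ^ d * d * ENNReal.ofReal (1 / n) ^ 2 + ENNReal.ofReal ((1 / (n : ℝ)) ^ 2))
      = ENNReal.ofReal ((2 ^ d * d + 1) * (1 / (n : ℝ)) ^ 2) := by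
    rw [← ENNReal.ofReal_pow hδ.le, add_mul, one_mul, ENNReal.ofReal_add (by positivity)
      (by positivity), ENNReal.ofReal_mul (by positivity), ENNReal.ofReal_mul (by positivity),
      ENNReal.ofReal_pow zero_le_two, ENNReal.ofReal_natCast, ENNReal.ofReal_ofNat]
  rw [h2, h3, ← ofReal_norm, ← ofReal_norm, ← ENNReal.ofReal_pow (norm_nonneg _),
    ← ENNReal.ofReal_pow (norm_nonneg _), ← ENNReal.ofReal_mul (by positivity),
    ENNReal.ofReal_le_ofReal_iff (by positivity)] at h1
  refine abs_le_of_sq_le_sq' ?_ (by positivity) |>.2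
  rw [mul_pow]
  exact h1.trans (by gcongr)

end AubinLions

end

/-! ### The theorem -/

theorem mainTheorem5 (d : ℕ) :
    (Function.Injective (AubinLions.weightedH1ToL2 d) ∧
      IsCompactOperator (AubinLions.weightedH1ToL2 d)) ∧
    ∀ (T : ℝ), 0 < T →
      ∀ (p q : ℝ≥0∞) [Fact (1 ≤ p)] [Fact (1 ≤ q)], ¬ (p = ⊤ ∧ q = 1) →
        ∀ (k : ℝ), 1 ≤ k →
          Function.Injective (AubinLions.aubinLionsEmbedding d p q T k) ∧
            IsCompactOperator (AubinLions.aubinLionsEmbedding d p q T k) := by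
  have hc : IsCompactOperator (AubinLions.weightedH1ToL2 d) :=
    AubinLions.isCompactOperator_weightedH1ToL2 d
  exact ⟨⟨AubinLions.weightedH1ToL2_injective d, hc⟩, fun T hT p q _ _ hpq k _ =>
    ⟨AubinLions.aubinLionsEmbedding_injective d p q T k,
      AubinLions.isCompactOperator_aubinLionsEmbedding d p q hpq hT k hc⟩⟩
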